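/- **Setting.** Let $T\ge 1$. In round $t\in\{1,\dots,T\}$ valuations $(s_t,b_t)\in[0,1]^2$ are drawn, independently over rounds, from distributions $\mathcal L_t$ on $[0,1]^2$ fixed in advance; the learner posts $(p_t,q_t)\in[0,1]^2$ and only observes the bit $\mathbb I(s_t\le p_t,\,b_t\ge q_t)$. Put $\mathrm{GFT}(p,q,s,b)=(b-s)\,\mathbb I(s\le p,b\ge q)$, $\mathrm{Rev}(p,q,s,b)=(q-p)\,\mathbb I(s\le p,b\ge q)$, $\mathrm{GFT}_t(p,q)=\mathrm{GFT}(p,q,s_t,b_t)$, $\mathrm{Rev}_t(p,q)=\mathrm{Rev}(p,q,s_t,b_t)$. For a distribution $\mathcal P$ on $[0,1]^2$ let $C=\sum_{t=1}^T\|\mathcal L_t-\mathcal P\|_{\mathrm{TV}}$, where $\|\mu-\nu\|_{\mathrm{TV}}=\sup_A|\mu(A)-\nu(A)|$. For $K\ge 2$ let $\mathcal G_K=\{(\tfrac{i}{K-1},\tfrac{j}{K-1}):0\le i,j\le K-1\}$. **Benchmarks.** $\mathrm{Opt}^{F}=\sup_{p\in[0,1]}\sum_{t=1}^T\mathrm{GFT}_t(p,p)$.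 $\mathrm{Opt}^{D}$ is the supremum of $\sum_{t=1}^T\mathbb E_{(p,q)\sim\pi,(s,b)\sim\mathcal L_t}[\mathrm{GFT}(p,q,s,b)]$ over the distributions $\pi$ on $[0,1]^2$ with $\sum_{t=1}^T\mathbb E_{(p,q)\sim\pi,(s,b)\sim\mathcal L_t}[\mathrm{Rev}(p,q,s,b)]\ge 0$; $\mathrm{Opt}^{D}_K$ is the same supremum over such $\pi$ supported on $\mathcal G_K$; $\mathrm{Opt}^{F}_K$ is the supremum of the same objective over the $\pi$ supported on $\mathcal G_K$ with $\mathbb E_{(p,q)\sim\pi,(s,b)\sim\mathcal L_t}[\mathrm{Rev}(p,q,s,b)]\ge-\tfrac1K$ for every $t\le T$. Let $R_K=\mathrm{Opt}^{D}-\mathrm{Opt}^{D}_K$ and $R_{0,K}=\mathrm{Opt}^{F}-\mathrm{Opt}^{F}_K$. **Algorithm.** Let $M=16\log T$. Given two randomized pricing procedures, Rev-Max and Primal, start with budget $B_0=0$ and multiplier $0$. In round $t$, if $B_{t-1}<1$, post the prices of Rev-Max and return the trade bit to it ($t\in\mathcal T_1$), leaving the multiplier unchanged. Otherwise ($t\in\mathcal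 T_2$) post the prices of Primal, return to it the trade bit and the current multiplier $\lambda_t$, and replace the multiplier by the projection of $\lambda_t-\mathrm{Rev}_t(p_t,q_t)/\sqrt T$ onto $[0,M]$. In both cases $B_t=B_{t-1}+\mathrm{Rev}_t(p_t,q_t)$. The primal regret is $$R_T^P=\sup_{\pi\in\Delta(\mathcal G_K)}\sum_{t\in\mathcal T_2}\Big(\mathbb E_{(p,q)\sim\pi}[\mathrm{GFT}_t(p,q)+\lambda_t\mathrm{Rev}_t(p,q)]-\mathrm{GFT}_t(p_t,q_t)-\lambda_t\mathrm{Rev}_t(p_t,q_t)\Big)$$ and the (weakly adaptive) dual regret is $$R_T^D=\sup_{1\le t_1\le t_2\le T,\ \lambda\in[0,M]}\ \sum_{t\in\mathcal T_2\cap[t_1,t_2]}(\lambda_t-\lambda)\,\mathrm{Rev}_t(p_t,q_t).$$ **Lemma.** For each $T$ there is a one-bit-feedback procedure Rev-Max, depending only on $T$ and posting only prices with $p\le q$, such that for every $\kappa>0$ there are constants $A,c,d$ for which the following holds for all $T\ge1$, $K\ge2$, all $\mathcal L_1,\dots,\mathcal L_T$ and $\mathcal P$, and every procedure Primal. With probability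 at least $1-c/T$, the algorithm satisfies $$\mathrm{Opt}^{D}-\sum_{t=1}^T\mathrm{GFT}_t(p_t,q_t)\le R_T^P+2R_T^D+2M\cdot C+A\,T^{3/4}(1+\log T)^d+R_K,$$ and, if moreover $T^{1/4}\le\kappa K$, on the same event $$\mathrm{Opt}^{F}-\sum_{t=1}^T\mathrm{GFT}_t(p_t,q_t)\le R_T^P+2R_T^D+A\,T^{3/4}(1+\log T)^d+R_{0,K}.$$ -/

import Mathlib

open MeasureTheory

noncomputable section

namespace BilateralTrade

/-- A point of `[0,1]²`: either a pair of posted prices `(p, q)` (`p` to the seller, `q` to the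
buyer) or a pair of valuations `(s, b)` (`s` of the seller, `b` of the buyer). -/
abbrev Pair : Type := unitInterval × unitInterval

/-- The one-bit feedback: does the trade occur at prices `a = (p, q)` and valuations
`x = (s, b)`, i.e. `s ≤ p` and `b ≥ q`? -/
def trade (a x : Pair) : Bool := decide (x.1 ≤ a.1 ∧ a.2 ≤ x.2)

/-- Gain from trade `(b - s) 𝟙(s ≤ p, b ≥ q)`. -/
def gft (a x : Pair) : ℝ := if trade a x then (x.2 : ℝ) - (x.1 : ℝ) else 0

/-- Revenue `(q - p) 𝟙(s ≤ p, b ≥ q)`. -/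
def rev (a x : Pair) : ℝ := if trade a x then (a.2 : ℝ) - (a.1 : ℝ) else 0

/-- `E_{(p,q) ∼ π}[GFT(p, q, s, b)]` at fixed valuations. -/
def polGft (π : ProbabilityMeasure Pair) (x : Pair) : ℝ := ∫ a, gft a x ∂(π : Measure Pair)

/-- `E_{(p,q) ∼ π}[Rev(p, q, s, b)]` at fixed valuations. -/
def polRev (π : ProbabilityMeasure Pair) (x : Pair) : ℝ := ∫ a, rev a x ∂(π : Measure Pair)

/-- `E_{(p,q) ∼ π, (s,b) ∼ L}[GFT(p, q, s, b)]`. -/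
def expGft (π L : ProbabilityMeasure Pair) : ℝ := ∫ x, polGft π x ∂(L : Measure Pair)

/-- `E_{(p,q) ∼ π, (s,b) ∼ L}[Rev(p, q, s, b)]`. -/
def expRev (π L : ProbabilityMeasure Pair) : ℝ := ∫ x, polRev π x ∂(L : Measure Pair)

/-- Total variation distance `sup_A |μ(A) - ν(A)|`. -/
def tv (μ ν : ProbabilityMeasure Pair) : ℝ :=
  sSup {r | ∃ A : Set Pair, MeasurableSet A ∧
    r = |(μ : Measure Pair).real A - (ν : Measure Pair).real A|}

/-- The total corruption `C = ∑_t ‖L_t - P‖_TV`. Rounds are numbered `0, …, T - 1`. -/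
def corruption (T : ℕ) (L : ℕ → ProbabilityMeasure Pair) (P : ProbabilityMeasure Pair) : ℝ :=
  ∑ t ∈ Finset.range T, tv (L t) P

/-! ### Benchmarks -/

/-- The uniform grid `{(i/(K-1), j/(K-1)) : 0 ≤ i, j ≤ K-1}` (used for `K ≥ 2`). -/
def grid (K : ℕ) : Set Pair :=
  {a | ∃ i j : Fin K, (a.1 : ℝ) = (i : ℝ) / ((K : ℝ) - 1) ∧ (a.2 : ℝ) = (j : ℝ) / ((K : ℝ) - 1)}

/-- The distributions over price pairs that are supported on the grid. -/
def gridPolicies (K : ℕ) : Set (ProbabilityMeasure Pair) :=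
  {π | (π : Measure Pair) (grid K)ᶜ = 0}

/-- The fixed-price benchmark `sup_p ∑_t GFT_t(p, p)` for the realized valuations `v`. -/
def optF (T : ℕ) (v : ℕ → Pair) : ℝ :=
  sSup {r | ∃ p : unitInterval, r = ∑ t ∈ Finset.range T, gft (p, p) (v t)}

/-- The distributional benchmark: the best distribution over prices that is budget balanced in
expectation over all the rounds. -/
def optD (T : ℕ) (L : ℕ → ProbabilityMeasure Pair) : ℝ :=
  sSup {r | ∃ π : ProbabilityMeasure Pair, 0 ≤ ∑ t ∈ Finset.range T, expRev π (L t) ∧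
    r = ∑ t ∈ Finset.range T, expGft π (L t)}

/-- The distributional benchmark on the grid. -/
def optDGrid (T K : ℕ) (L : ℕ → ProbabilityMeasure Pair) : ℝ :=
  sSup {r | ∃ π ∈ gridPolicies K, 0 ≤ ∑ t ∈ Finset.range T, expRev π (L t) ∧
    r = ∑ t ∈ Finset.range T, expGft π (L t)}

/-- The fixed-price benchmark on the grid: the best distribution on the grid whose expected
revenue is at least `-1/K` in each round. -/
def optFGrid (T K : ℕ) (L : ℕ → ProbabilityMeasure Pair) : ℝ :=
  sSup {r | ∃ π ∈ gridPolicies K, (∀ t ∈ Finset.range T, -(1 / (K : ℝ)) ≤ expRev π (L t)) ∧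
    r = ∑ t ∈ Finset.range T, expGft π (L t)}

/-- The approximation regret `R_K` of the distributional benchmark. -/
def gridRegretD (T K : ℕ) (L : ℕ → ProbabilityMeasure Pair) : ℝ := optD T L - optDGrid T K L

/-- The approximation regret `R_{0,K}` of the fixed-price benchmark. -/
def gridRegretF (T K : ℕ) (L : ℕ → ProbabilityMeasure Pair) (v : ℕ → Pair) : ℝ :=
  optF T v - optFGrid T K L

/-! ### The algorithm -/

/-- A randomized pricing procedure that receives an observation in `Obs` after each of its rounds.
All its internal randomness is drawn beforehand as a seed; its next price pair is a
function of the seed and of the list (oldest first) of the observations received so far.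
In particular it learns nothing about the valuations beyond its observations. -/
structure Procedure (Obs : Type) [MeasurableSpace Obs] where
  Seed : Type
  measSeed : MeasurableSpace Seed
  law : Measure Seed
  isProb : IsProbabilityMeasure law
  price : Seed → List Obs → Pair
  measurable_price : ∀ n : ℕ, Measurable fun x : Seed × (Fin n → Obs) => price x.1 (List.ofFn x.2)

attribute [instance] Procedure.measSeed Procedure.isProb

/-- The procedure never subsidizes a trade: it posts only `(p, q)` with `p ≤ q`. -/
def NoSubsidy {Obs : Type} [MeasurableSpace Obs] (R : Procedure Obs) : Prop :=
  ∀ (ω : R.Seed) (h : List Obs), (R.price ω h).1 ≤ (R.price ω h).2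

/-- The bound `M = 16 log T` on the dual variables. -/
def dualBound (T : ℕ) : ℝ := 16 * Real.log T

/-- The state of the algorithm before a round: the budget `B`, the current multiplier `lam` of the
dual player, the feedback that Rev-Max has received in its rounds (trade bits), and the feedback
that the primal procedure has received in its rounds (trade bits and multipliers). -/
structure State where
  budget : ℝ
  lam : ℝ
  revHist : List Bool
  primalHist : List (Bool × ℝ)

/-- The initial state: zero budget, zero multiplier, empty histories. -/
def State.init : State := ⟨0, 0, [], []⟩

section Run

variable (R : Procedure Bool) (Q : Procedure (Bool × ℝ)) (T : ℕ) (ωR : R.Seed) (ωQ : Q.Seed)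

/-- The prices posted from a state: Rev-Max is called if the budget is below `1`, and Primal-Dual
otherwise. -/
def State.prices (S : State) : Pair :=
  open Classical in if S.budget < 1 then R.price ωR S.revHist else Q.price ωQ S.primalHist

/-- One round, with valuations `x`. In a Primal-Dual round the multiplier makes the projected
gradient step `lam ← Π_[0,M](lam - Rev / √T)`; in a Rev-Max round it is left unchanged. -/
def State.step (S : State) (x : Pair) : State :=
  open Classical in
  if S.budget < 1 then
    { S with
      budget := S.budget + rev (S.prices R Q ωR ωQ) x
      revHist := S.revHist ++ [trade (S.prices R Q ωR ωQ) x] }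
  else
    { S with
      budget := S.budget + rev (S.prices R Q ωR ωQ) x
      lam := max 0 (min (dualBound T) (S.lam - 1 / √(T : ℝ) * rev (S.prices R Q ωR ωQ) x))
      primalHist := S.primalHist ++ [(trade (S.prices R Q ωR ωQ) x, S.lam)] }

/-- The state before round `t`, when the valuations are `v 0, v 1, …`. -/
def run (v : ℕ → Pair) : ℕ → State
  | 0 => State.init
  | t + 1 => (run v t).step R Q T ωR ωQ (v t)

/-- The prices `(p_t, q_t)` posted by the algorithm in round `t`. -/
def posted (v : ℕ → Pair) (t : ℕ) : Pair := (run R Q T ωR ωQ v t).prices R Q ωR ωQ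

/-- The cumulative gain from trade of the algorithm. -/
def totalGft (v : ℕ → Pair) : ℝ :=
  ∑ t ∈ Finset.range T, gft (posted R Q T ωR ωQ v t) (v t)

/-- The set of the rounds in which the algorithm follows Primal-Dual. -/
def pdRounds (v : ℕ → Pair) : Finset ℕ :=
  open Classical in (Finset.range T).filter fun t => ¬ (run R Q T ωR ωQ v t).budget < 1

/-- The primal regret `R_T^P`: the regret of the primal procedure, over the rounds in which it is
active and with respect to the Lagrangian reward `GFT_t + λ_t Rev_t`, against the best
distribution on the grid. -/
def primalRegret (K : ℕ) (v : ℕ → Pair) : ℝ :=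
  sSup {r | ∃ π ∈ gridPolicies K, r = ∑ t ∈ pdRounds R Q T ωR ωQ v,
    ((polGft π (v t) + (run R Q T ωR ωQ v t).lam * polRev π (v t)) -
      (gft (posted R Q T ωR ωQ v t) (v t) +
        (run R Q T ωR ωQ v t).lam * rev (posted R Q T ωR ωQ v t) (v t)))}

/-- The dual (weakly adaptive) regret `R_T^D`: the largest regret of the multipliers, over the
Primal-Dual rounds of any interval `[t₁, t₂]`, against any fixed multiplier in `[0, M]`. -/
def dualRegret (v : ℕ → Pair) : ℝ :=
  sSup {r | ∃ t₁ t₂ : ℕ, t₁ ≤ t₂ ∧ t₂ < T ∧ ∃ μ ∈ Set.Icc 0 (dualBound T),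
    r = ∑ t ∈ pdRounds R Q T ωR ωQ v ∩ Finset.Icc t₁ t₂,
      ((run R Q T ωR ωQ v t).lam - μ) * rev (posted R Q T ωR ωQ v t) (v t)}

/-- The joint law of the seed of Rev-Max, the seed of the primal procedure and the valuations:
all independent, with valuations of law `L t` in round `t`. -/
def jointLaw (L : ℕ → ProbabilityMeasure Pair) : Measure (R.Seed × Q.Seed × (ℕ → Pair)) :=
  R.law.prod (Q.law.prod (Measure.infinitePi fun t => (L t : Measure Pair)))

end Run

end BilateralTrade

end

namespace BilateralTrade

/-! ### Pointwise bounds on gain from trade and revenue -/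

/-! In each bound the continuous benchmark cancels against the approximation regret, so it suffices
to compare the algorithm with one near-optimal grid policy `π`, fixed before the valuations are
drawn. Weight the revenue of round `t` by `w_t`, equal to `1` in Rev-Max rounds and to the
multiplier `λ_t` in Primal-Dual rounds, and consider the expected total of `GFT + w_t Rev` under
`π`. Since `0 ≤ w_t ≤ M` for large `T`, the revenue part is at least `-2MC` in the distributional
case (`neg_corruption_le_sum_mul_expRev`) and at least `-MT/K` in the fixed-price case. Since `w_t`
depends only on the past, an exponential supermartingale (`jointLaw_rewardGap`) replaces expected
rewards by realized ones at a cost of order `M √T log T`.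

On the Primal-Dual rounds the realized reward is controlled by the primal regret and by `∑ λ_t
Rev_t`. The latter is at most `2 R_T^D + 2M - M S`, where `S` is the revenue collected by Rev-Max
(`sum_lam_mul_rev_le`): up to the last Rev-Max round all the revenue sums to at most `2`, so
comparing with the multiplier `M` before that round, and with `0` after it, credits `S` at rate `M`.
On the Rev-Max rounds the reward of any price pair is at most the gain from trade of two fixed
prices (`gft_add_rev_le`). The credit `M S` pays for this if Rev-Max earns a `1 / log T` fraction of
the best fixed-price gain from trade.

Two ingredients give such a Rev-Max. First, splitting `b - s` at a price and truncating both halves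
dyadically covers the gain from trade of that price by the revenues of `2(J+1)` balanced arms, up to
`4 / 2^J` per round (`exists_gft_le_sum_rev`). Second, an exponential-weights bandit over these arms
has multiplicative regret: each arm earns at most `8 S` plus a term of order (number of arms) · log
(`jointLaw_bandit_regret`). With `2^J` of order `T^{1/4}`, discretization costs `T^{3/4}`, and the
total coefficient `32 (J+1)` of `S` is at most `M = 16 log T` once `T ≥ 2^15`. -/

theorem trade_iff (a x : Pair) : trade a x = true ↔ (x.1 : ℝ) ≤ a.1 ∧ (a.2 : ℝ) ≤ x.2 := by
  simp [trade]

theorem gft_of_trade {a x : Pair} (h : (x.1 : ℝ) ≤ a.1 ∧ (a.2 : ℝ) ≤ x.2) :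
    gft a x = (x.2 : ℝ) - x.1 := by
  rw [gft, if_pos ((trade_iff a x).2 h)]

theorem gft_of_not_trade {a x : Pair} (h : ¬ ((x.1 : ℝ) ≤ a.1 ∧ (a.2 : ℝ) ≤ x.2)) :
    gft a x = 0 := by
  rw [gft, if_neg (fun h' => h ((trade_iff a x).1 h'))]

theorem rev_of_trade {a x : Pair} (h : (x.1 : ℝ) ≤ a.1 ∧ (a.2 : ℝ) ≤ x.2) :
    rev a x = (a.2 : ℝ) - a.1 := by
  rw [rev, if_pos ((trade_iff a x).2 h)]

theorem rev_of_not_trade {a x : Pair} (h : ¬ ((x.1 : ℝ) ≤ a.1 ∧ (a.2 : ℝ) ≤ x.2)) :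
    rev a x = 0 := by
  rw [rev, if_neg (fun h' => h ((trade_iff a x).1 h'))]

theorem abs_gft_le_one (a x : Pair) : |gft a x| ≤ 1 := by
  have h1 := x.1.2.1
  have h2 := x.1.2.2
  have h3 := x.2.2.1
  have h4 := x.2.2.2
  rw [abs_le, gft]
  split_ifs <;> constructor <;> linarith

theorem abs_rev_le_one (a x : Pair) : |rev a x| ≤ 1 := by
  have h1 := a.1.2.1
  have h2 := a.1.2.2
  have h3 := a.2.2.1
  have h4 := a.2.2.2
  rw [abs_le, rev]
  split_ifs <;> constructor <;> linarith

theorem gft_nonneg_of_le {a : Pair} (h : a.1 ≤ a.2) (x : Pair) : 0 ≤ gft a x := by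
  have h' : (a.1 : ℝ) ≤ a.2 := h
  by_cases ht : (x.1 : ℝ) ≤ a.1 ∧ (a.2 : ℝ) ≤ x.2
  · rw [gft_of_trade ht]; linarith [ht.1, ht.2]
  · rw [gft_of_not_trade ht]

theorem rev_nonneg_of_le {a : Pair} (h : a.1 ≤ a.2) (x : Pair) : 0 ≤ rev a x := by
  have h' : (a.1 : ℝ) ≤ a.2 := h
  rw [rev]; split_ifs <;> linarith

/-- The gain from trade plus the revenue of any price pair is at most the gain from trade of the
two balanced pairs at its endpoints. -/
theorem gft_add_rev_le (a x : Pair) :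
    gft a x + rev a x ≤ gft (a.1, a.1) x + gft (a.2, a.2) x := by
  have n1 := gft_nonneg_of_le (a := (a.1, a.1)) le_rfl x
  have n2 := gft_nonneg_of_le (a := (a.2, a.2)) le_rfl x
  by_cases ht : (x.1 : ℝ) ≤ a.1 ∧ (a.2 : ℝ) ≤ x.2
  · rw [gft_of_trade ht, rev_of_trade ht]
    -- If both endpoint prices trade, `q - p ≤ b - s` suffices. If only one does, then `q < p` and
    -- the revenue is negative; if neither does, the left side is negative.
    by_cases h1 : (a.1 : ℝ) ≤ x.2 <;> by_cases h2 : (x.1 : ℝ) ≤ a.2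
    · rw [gft_of_trade (a := (a.1, a.1)) ⟨ht.1, h1⟩, gft_of_trade (a := (a.2, a.2)) ⟨h2, ht.2⟩]
      linarith [ht.1, ht.2]
    · rw [gft_of_trade (a := (a.1, a.1)) ⟨ht.1, h1⟩]
      linarith [ht.1, ht.2]
    · rw [gft_of_trade (a := (a.2, a.2)) ⟨h2, ht.2⟩]
      linarith [ht.1, ht.2]
    · linarith [ht.1, ht.2]
  · rw [gft_of_not_trade ht, rev_of_not_trade ht]
    linarith

/-! ### Measurability and expectations -/

theorem measurable_trade : Measurable fun y : Pair × Pair => trade y.1 y.2 := by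
  refine measurable_to_bool ?_
  have : (fun y : Pair × Pair => trade y.1 y.2) ⁻¹' {true}
      = {y | y.2.1 ≤ y.1.1} ∩ {y | y.1.2 ≤ y.2.2} := by
    ext y; simp [trade]
  rw [this]
  exact (measurableSet_le (by fun_prop) (by fun_prop)).inter
    (measurableSet_le (by fun_prop) (by fun_prop))

theorem measurable_gft : Measurable fun y : Pair × Pair => gft y.1 y.2 :=
  Measurable.ite (measurable_trade (measurableSet_singleton true)) (by fun_prop) (by fun_prop)

theorem measurable_rev : Measurable fun y : Pair × Pair => rev y.1 y.2 :=
  Measurable.ite (measurable_trade (measurableSet_singleton true)) (by fun_prop) (by fun_prop)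

theorem integrable_of_abs_le {X : Type*} [MeasurableSpace X] {μ : Measure X} [IsFiniteMeasure μ]
    {f : X → ℝ} (hf : Measurable f) {c : ℝ} (hc : ∀ x, |f x| ≤ c) : Integrable f μ :=
  Integrable.of_bound hf.aestronglyMeasurable c (Filter.Eventually.of_forall hc)

theorem abs_integral_le_of_abs_le {X : Type*} [MeasurableSpace X] {μ : Measure X}
    [IsProbabilityMeasure μ] {f : X → ℝ} {c : ℝ} (hc : ∀ x, |f x| ≤ c) :
    |∫ x, f x ∂μ| ≤ c := by
  have h : ∀ᵐ x ∂μ, ‖f x‖ ≤ c := Filter.Eventually.of_forall hc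
  simpa using norm_integral_le_of_norm_le_const h

theorem integrable_gft (π : ProbabilityMeasure Pair) (x : Pair) :
    Integrable (fun a => gft a x) (π : Measure Pair) :=
  integrable_of_abs_le (measurable_gft.comp (by fun_prop : Measurable fun a : Pair => (a, x)))
    fun a => abs_gft_le_one a x

theorem integrable_rev (π : ProbabilityMeasure Pair) (x : Pair) :
    Integrable (fun a => rev a x) (π : Measure Pair) :=
  integrable_of_abs_le (measurable_rev.comp (by fun_prop : Measurable fun a : Pair => (a, x)))
    fun a => abs_rev_le_one a x

theorem abs_polGft_le_one (π : ProbabilityMeasure Pair) (x : Pair) : |polGft π x| ≤ 1 :=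
  abs_integral_le_of_abs_le fun a => abs_gft_le_one a x

theorem abs_polRev_le_one (π : ProbabilityMeasure Pair) (x : Pair) : |polRev π x| ≤ 1 :=
  abs_integral_le_of_abs_le fun a => abs_rev_le_one a x

theorem measurable_polGft (π : ProbabilityMeasure Pair) : Measurable (polGft π) := by
  have h : StronglyMeasurable fun y : Pair × Pair => gft y.2 y.1 :=
    (measurable_gft.comp measurable_swap).stronglyMeasurable
  exact h.integral_prod_right.measurable

theorem measurable_polRev (π : ProbabilityMeasure Pair) : Measurable (polRev π) := by
  have h : StronglyMeasurable fun y : Pair × Pair => rev y.2 y.1 :=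
    (measurable_rev.comp measurable_swap).stronglyMeasurable
  exact h.integral_prod_right.measurable

/-- Averaging `gft_add_rev_le` over `a ∼ π`: each coordinate of `a` acts as a fixed price, which
gives the factor `2`. -/
theorem polGft_add_polRev_sum_le (π : ProbabilityMeasure Pair) (s : Finset ℕ) (v : ℕ → Pair)
    {D : ℝ} (hD : ∀ p, ∑ t ∈ s, gft (p, p) (v t) ≤ D) :
    ∑ t ∈ s, (polGft π (v t) + polRev π (v t)) ≤ 2 * D := by
  have hi : ∀ t ∈ s, Integrable (fun a => gft a (v t) + rev a (v t)) (π : Measure Pair) :=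
    fun t _ => (integrable_gft π (v t)).add (integrable_rev π (v t))
  have h : ∑ t ∈ s, (polGft π (v t) + polRev π (v t))
      = ∫ a, ∑ t ∈ s, (gft a (v t) + rev a (v t)) ∂(π : Measure Pair) := by
    rw [integral_finsetSum _ hi]
    refine Finset.sum_congr rfl fun t _ => ?_
    rw [integral_add (integrable_gft π (v t)) (integrable_rev π (v t))]
    rfl
  rw [h]
  calc ∫ a, ∑ t ∈ s, (gft a (v t) + rev a (v t)) ∂(π : Measure Pair)
      ≤ ∫ _, 2 * D ∂(π : Measure Pair) := by
        refine integral_mono (integrable_finsetSum _ hi) (integrable_const _) fun a => ?_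
        calc ∑ t ∈ s, (gft a (v t) + rev a (v t))
            ≤ ∑ t ∈ s, (gft (a.1, a.1) (v t) + gft (a.2, a.2) (v t)) :=
              Finset.sum_le_sum fun t _ => gft_add_rev_le a (v t)
          _ ≤ 2 * D := by
              rw [Finset.sum_add_distrib]
              linarith [hD a.1, hD a.2]
    _ = 2 * D := by simp

/-! ### Total variation -/

theorem abs_real_sub_le_tv (μ ν : ProbabilityMeasure Pair) {A : Set Pair} (hA : MeasurableSet A) :
    |(μ : Measure Pair).real A - (ν : Measure Pair).real A| ≤ tv μ ν := by
  refine le_csSup ⟨1, ?_⟩ ⟨A, hA, rfl⟩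
  rintro r ⟨B, -, rfl⟩
  rw [abs_le]
  constructor <;>
  linarith [measureReal_nonneg (μ := (μ : Measure Pair)) (s := B),
    measureReal_nonneg (μ := (ν : Measure Pair)) (s := B),
    measureReal_le_one (μ := (μ : Measure Pair)) (s := B),
    measureReal_le_one (μ := (ν : Measure Pair)) (s := B)]

theorem tv_nonneg (μ ν : ProbabilityMeasure Pair) : 0 ≤ tv μ ν :=
  (abs_nonneg _).trans (abs_real_sub_le_tv μ ν MeasurableSet.empty)

theorem expRev_eq_integral (π L : ProbabilityMeasure Pair) :
    expRev π L = ∫ a, ((a.2 : ℝ) - a.1) * (L : Measure Pair).real {x | trade a x = true}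
      ∂(π : Measure Pair) := by
  have hint : Integrable (Function.uncurry fun x a : Pair => rev a x)
      ((L : Measure Pair).prod (π : Measure Pair)) :=
    integrable_of_abs_le (c := 1) (measurable_rev.comp measurable_swap)
      fun y => abs_rev_le_one y.2 y.1
  rw [expRev]
  simp only [polRev]
  rw [integral_integral_swap hint]
  refine integral_congr_ae (Filter.Eventually.of_forall fun a => ?_)
  have hm : MeasurableSet {x | trade a x = true} :=
    (measurable_trade.comp (by fun_prop : Measurable fun x : Pair => (a, x)))
      (measurableSet_singleton true)
  have : (fun x => rev a x) = {x | trade a x = true}.indicator fun _ => (a.2 : ℝ) - a.1 := by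
    ext x; simp [rev, Set.indicator_apply]
  simp only [this]
  rw [integral_indicator_const _ hm, smul_eq_mul, mul_comm]

/-- For a fixed price pair the expected revenue is the markup, of absolute value at most `1`, times
the probability of a single event. Hence no factor `2` appears. -/
theorem abs_expRev_sub_le_tv (π L P : ProbabilityMeasure Pair) :
    |expRev π L - expRev π P| ≤ tv L P := by
  have key : ∀ a : Pair, |((a.2 : ℝ) - a.1)| ≤ 1 := fun a => by
    have h1 := a.1.2.1
    have h2 := a.1.2.2
    have h3 := a.2.2.1
    have h4 := a.2.2.2
    rw [abs_le]; constructor <;> linarith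
  have hint : ∀ M : ProbabilityMeasure Pair,
      Integrable (fun a : Pair => ((a.2 : ℝ) - a.1) * (M : Measure Pair).real {x | trade a x = true})
        (π : Measure Pair) := fun M => by
    refine integrable_of_abs_le (c := 1) ?_ fun a => ?_
    · have hs : MeasurableSet {y : Pair × Pair | trade y.1 y.2 = true} :=
        measurable_trade (measurableSet_singleton true)
      have := (measurable_measure_prodMk_left (ν := (M : Measure Pair)) hs).ennreal_toReal
      exact Measurable.mul (by fun_prop) this
    · rw [abs_mul, abs_of_nonneg measureReal_nonneg]
      exact mul_le_one₀ (key a) measureReal_nonneg measureReal_le_one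
  rw [expRev_eq_integral, expRev_eq_integral, ← integral_sub (hint L) (hint P)]
  refine abs_integral_le_of_abs_le fun a => ?_
  rw [← mul_sub, abs_mul]
  calc _ ≤ 1 * tv L P := by
        refine mul_le_mul (key a) (abs_real_sub_le_tv L P ?_) (abs_nonneg _) zero_le_one
        exact (measurable_trade.comp (by fun_prop : Measurable fun x : Pair => (a, x)))
          (measurableSet_singleton true)
    _ = tv L P := one_mul _

/-- A policy with nonnegative total revenue keeps, up to twice the corruption, a nonnegative
revenue under every reweighting of the rounds. -/
theorem neg_corruption_le_sum_mul_expRev {T : ℕ} {L : ℕ → ProbabilityMeasure Pair}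
    (P π : ProbabilityMeasure Pair) (h0 : 0 ≤ ∑ t ∈ Finset.range T, expRev π (L t))
    {c : ℕ → ℝ} {M : ℝ} (hc : ∀ t, 0 ≤ c t ∧ c t ≤ M) :
    -(2 * M * corruption T L P) ≤ ∑ t ∈ Finset.range T, c t * expRev π (L t) := by
  have hM : 0 ≤ M := (hc 0).1.trans (hc 0).2
  set e := expRev π P
  have hd : ∀ t, |expRev π (L t) - e| ≤ tv (L t) P := fun t => abs_expRev_sub_le_tv π (L t) P
  -- The total constraint turns into a lower bound on the revenue `e` under the common law `P`.
  -- Returning from `P` to the `L t` with weights costs another `M` times the corruption.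
  have h1 : 0 ≤ (T : ℝ) * e + corruption T L P := by
    refine h0.trans ?_
    have : ∑ t ∈ Finset.range T, expRev π (L t) ≤ ∑ t ∈ Finset.range T, (e + tv (L t) P) :=
      Finset.sum_le_sum fun t _ => by linarith [(abs_le.1 (hd t)).2]
    rw [Finset.sum_add_distrib] at this
    simpa [corruption] using this
  have hC : 0 ≤ corruption T L P := Finset.sum_nonneg fun t _ => tv_nonneg _ _
  have h2 : ∑ t ∈ Finset.range T, (c t * e - M * tv (L t) P)
      ≤ ∑ t ∈ Finset.range T, c t * expRev π (L t) := by
    refine Finset.sum_le_sum fun t _ => ?_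
    have h3 := (abs_le.1 (hd t)).1
    have h4 : c t * (e - tv (L t) P) ≤ c t * expRev π (L t) :=
      mul_le_mul_of_nonneg_left (by linarith) (hc t).1
    have h5 := mul_le_mul_of_nonneg_right (hc t).2 (tv_nonneg (L t) P)
    linarith
  rw [Finset.sum_sub_distrib, ← Finset.sum_mul, ← Finset.mul_sum] at h2
  change _ - M * corruption T L P ≤ _ at h2
  have hS : ∑ t ∈ Finset.range T, c t ≤ T * M := by
    simpa using Finset.sum_le_sum fun t (_ : t ∈ Finset.range T) => (hc t).2
  have hS0 : 0 ≤ ∑ t ∈ Finset.range T, c t := Finset.sum_nonneg fun t _ => (hc t).1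
  have h6 : -(M * corruption T L P) ≤ (∑ t ∈ Finset.range T, c t) * e := by
    rcases le_total 0 e with he | he
    · have := mul_nonneg hS0 he
      have := mul_nonneg hM hC
      linarith
    · have := mul_le_mul_of_nonpos_right hS he
      have := mul_nonneg hM h1
      linarith
  linarith

end BilateralTrade

/-! ### Resampling one coordinate of a product measure -/

section Resample

variable {ι : Type*} [DecidableEq ι] {X : ι → Type*} [∀ i, MeasurableSpace (X i)]

theorem measurable_update_pair (i : ι) :
    Measurable fun y : (∀ j, X j) × X i => Function.update y.1 i y.2 := by
  refine measurable_pi_iff.2 fun j => ?_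
  by_cases h : j = i
  · subst h; simpa using measurable_snd
  · have : Measurable fun y : (∀ j, X j) × X i => y.1 j :=
      (measurable_pi_apply j).comp measurable_fst
    simpa [h] using this

variable (μ : ∀ i, Measure (X i)) [∀ i, IsProbabilityMeasure (μ i)]

/-- A product measure is determined by its values on finite boxes. The fresh draw supplies the
factor of coordinate `i` if the box constrains it, and is invisible otherwise. -/
theorem map_update_infinitePi (i : ι) :
    ((Measure.infinitePi μ).prod (μ i)).map (fun y => Function.update y.1 i y.2)
      = Measure.infinitePi μ := by
  refine Measure.eq_infinitePi _ fun s t ht => ?_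
  rw [Measure.map_apply (measurable_update_pair i)
    (MeasurableSet.pi s.countable_toSet fun j _ => ht j)]
  by_cases hi : i ∈ s
  · have : (fun y : (∀ j, X j) × X i => Function.update y.1 i y.2) ⁻¹' (Set.pi s t)
        = (Set.pi (s.erase i : Finset ι) t) ×ˢ (t i) := by
      ext y
      simp only [Set.mem_preimage, Set.mem_pi, Finset.mem_coe, Set.mem_prod, Finset.mem_erase]
      constructor
      · intro h
        refine ⟨fun j hj => ?_, by simpa using h i hi⟩
        simpa [hj.1] using h j hj.2
      · rintro ⟨h1, h2⟩ j hj
        by_cases hji : j = i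
        · subst hji; simpa using h2
        · simpa [hji] using h1 j ⟨hji, hj⟩
    rw [this, Measure.prod_prod, Measure.infinitePi_pi _ fun j _ => ht j, mul_comm,
      Finset.mul_prod_erase s (fun j => μ j (t j)) hi]
  · have : (fun y : (∀ j, X j) × X i => Function.update y.1 i y.2) ⁻¹' (Set.pi s t)
        = (Set.pi s t) ×ˢ Set.univ := by
      ext y
      simp only [Set.mem_preimage, Set.mem_pi, Finset.mem_coe, Set.mem_prod, Set.mem_univ, and_true]
      refine forall₂_congr fun j hj => ?_
      have : j ≠ i := fun h => hi (h ▸ hj)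
      simp [this]
    rw [this, Measure.prod_prod, Measure.infinitePi_pi _ fun j _ => ht j]
    simp

theorem lintegral_infinitePi_eq_resample (i : ι) {f : (∀ j, X j) → ENNReal} (hf : Measurable f) :
    ∫⁻ ω, f ω ∂Measure.infinitePi μ
      = ∫⁻ ω, ∫⁻ a, f (Function.update ω i a) ∂μ i ∂Measure.infinitePi μ := by
  conv_lhs => rw [← map_update_infinitePi μ i]
  rw [lintegral_map hf (measurable_update_pair i),
    lintegral_prod (fun y : (∀ j, X j) × X i => f (Function.update y.1 i y.2))
      (hf.comp (measurable_update_pair i)).aemeasurable]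

/-- If, given the other coordinates, the factor `Y` has mean at most one when the coordinate `H ω`
is resampled, and `H` and `F` do not depend on that coordinate, then multiplying `F` by `Y` does
not increase the integral. -/
theorem lintegral_mul_le_of_resample [Countable ι] {F Y : (∀ j, X j) → ENNReal}
    {H : (∀ j, X j) → ι} (hF : Measurable F) (hY : Measurable Y)
    (hHm : ∀ i, MeasurableSet {ω | H ω = i})
    (hH : ∀ ω a, H (Function.update ω (H ω) a) = H ω)
    (hFi : ∀ ω a, F (Function.update ω (H ω) a) = F ω)
    (hYi : ∀ ω, ∫⁻ a, Y (Function.update ω (H ω) a) ∂μ (H ω) ≤ 1) :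
    ∫⁻ ω, F ω * Y ω ∂Measure.infinitePi μ ≤ ∫⁻ ω, F ω ∂Measure.infinitePi μ := by
  -- The resampled coordinate is random; on each of the countably many events `H ω = i` it is fixed.
  have split : ∀ f : (∀ j, X j) → ENNReal, ∫⁻ ω, f ω ∂Measure.infinitePi μ
      = ∑' i, ∫⁻ ω, {ω | H ω = i}.indicator f ω ∂Measure.infinitePi μ := fun f => by
    have hU : (⋃ i, {ω | H ω = i}) = Set.univ := by ext ω; simp
    rw [← setLIntegral_univ, ← hU, lintegral_iUnion hHm]
    · exact tsum_congr fun i => (lintegral_indicator (hHm i) _).symm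
    · intro i j hij
      refine Set.disjoint_left.2 fun ω h1 h2 => hij (h1.symm.trans h2)
  rw [split, split F]
  refine ENNReal.tsum_le_tsum fun i => ?_
  have hH' : ∀ ω, H ω = i → ∀ a : X i, H (Function.update ω i a) = i := by
    rintro ω rfl a
    exact hH ω a
  -- The converse follows by resampling once more, back to the original value `ω i`.
  have hHi : ∀ ω a, H (Function.update ω i a) = i ↔ H ω = i := fun ω a =>
    ⟨fun h => by simpa using hH' _ h (ω i), fun h => hH' ω h a⟩
  rw [lintegral_infinitePi_eq_resample μ i (f := {ω | H ω = i}.indicator fun ω => F ω * Y ω)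
    ((hF.mul hY).indicator (hHm i))]
  refine lintegral_mono fun ω => ?_
  by_cases h : H ω = i
  · have h1 : ∀ a, {ω | H ω = i}.indicator (fun ω => F ω * Y ω) (Function.update ω i a)
        = F ω * Y (Function.update ω i a) := fun a => by
      rw [Set.indicator_of_mem (by exact (hHi ω a).2 h)]
      subst h
      rw [hFi]
    have h2 : {ω | H ω = i}.indicator F ω = F ω := Set.indicator_of_mem (by exact h) _
    calc ∫⁻ a, {ω | H ω = i}.indicator (fun ω => F ω * Y ω) (Function.update ω i a) ∂μ i
        = ∫⁻ a, F ω * Y (Function.update ω i a) ∂μ i := lintegral_congr h1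
      _ = F ω * ∫⁻ a, Y (Function.update ω i a) ∂μ i :=
          lintegral_const_mul _ (hY.comp ((measurable_update_pair i).comp measurable_prodMk_left))
      _ ≤ F ω * 1 := by
          gcongr
          subst h
          exact hYi ω
      _ = {ω | H ω = i}.indicator F ω := by rw [mul_one, h2]
  · have h1 : ∀ a, {ω | H ω = i}.indicator (fun ω => F ω * Y ω) (Function.update ω i a) = 0 :=
      fun a => Set.indicator_of_notMem (s := {ω | H ω = i})
        (show ¬ H _ = i from fun h' => h ((hHi ω a).1 h')) _
    calc ∫⁻ a, {ω | H ω = i}.indicator (fun ω => F ω * Y ω) (Function.update ω i a) ∂μ i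
        = ∫⁻ a, 0 ∂μ i := lintegral_congr h1
      _ ≤ _ := by simp

end Resample

/-- Markov's inequality for an exponential of integral at most one. -/
theorem measure_log_lt_le {Ω : Type*} [MeasurableSpace Ω] {μ : Measure Ω} {f : Ω → ℝ}
    (hf : Measurable f) (hint : ∫⁻ ω, ENNReal.ofReal (Real.exp (f ω)) ∂μ ≤ 1) {x : ℝ} (hx : 0 < x) :
    μ {ω | Real.log x < f ω} ≤ ENNReal.ofReal (1 / x) := by
  have hm : Measurable fun ω => ENNReal.ofReal (Real.exp (f ω)) :=
    (Real.measurable_exp.comp hf).ennreal_ofReal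
  have h1 : μ {ω | Real.log x < f ω}
      ≤ μ {ω | ENNReal.ofReal x ≤ ENNReal.ofReal (Real.exp (f ω))} := by
    refine measure_mono fun ω hω => ENNReal.ofReal_le_ofReal ?_
    rw [← Real.exp_log hx]
    exact Real.exp_le_exp.2 (le_of_lt hω)
  refine h1.trans ((meas_ge_le_lintegral_div hm.aemeasurable (by simpa using hx)
    ENNReal.ofReal_ne_top).trans ?_)
  rw [ENNReal.ofReal_div_of_pos hx, ENNReal.ofReal_one]
  gcongr

/-! ### The measurable structure on lists -/

section ListMeasurable

variable {α β γ : Type*} [MeasurableSpace α] [MeasurableSpace β] [MeasurableSpace γ]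

/-- A set of lists is measurable if its part of each length is. -/
instance List.measurableSpaceOfFn : MeasurableSpace (List α) :=
  ⨅ n : ℕ, MeasurableSpace.map (fun x : Fin n → α => List.ofFn x) inferInstance

theorem measurableSet_list_iff {s : Set (List α)} :
    MeasurableSet s ↔ ∀ n, MeasurableSet ((fun x : Fin n → α => List.ofFn x) ⁻¹' s) := by
  simp only [MeasurableSpace.measurableSet_iInf, MeasurableSpace.map_def]

theorem measurable_ofFn (n : ℕ) : Measurable fun x : Fin n → α => List.ofFn x :=
  fun _ hs => measurableSet_list_iff.1 hs n

theorem measurable_of_ofFn {f : List α → γ} (hf : ∀ n, Measurable fun x : Fin n → α =>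
    f (List.ofFn x)) : Measurable f :=
  fun _ hs => measurableSet_list_iff.2 fun n => hf n hs

theorem measurable_list_length : Measurable (List.length : List α → ℕ) :=
  measurable_of_ofFn fun n => by simp

theorem measurable_list_getD (i : ℕ) (d : α) : Measurable fun l : List α => l.getD i d := by
  refine measurable_of_ofFn fun n => ?_
  by_cases h : i < n
  · simpa [List.getD_eq_getElem?_getD, h] using
      measurable_pi_apply (X := fun _ : Fin n => α) ⟨i, h⟩
  · simp [List.getD_eq_getElem?_getD, h]

/-- The lists of length `n` form a measurable piece, on which the list is recovered from its
entries; the default value in `getD` is never used there. -/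
theorem measurable_prod_list_of_ofFn [Inhabited α] {f : β × List α → γ}
    (hf : ∀ n, Measurable fun x : β × (Fin n → α) => f (x.1, List.ofFn x.2)) : Measurable f := by
  intro s hs
  have hg : ∀ n, Measurable fun y : β × List α =>
      (y.1, fun i : Fin n => y.2.getD i default) := fun n =>
    measurable_fst.prodMk
      (measurable_pi_iff.2 fun i => (measurable_list_getD i default).comp measurable_snd)
  have hU : f ⁻¹' s = ⋃ n, {y : β × List α | y.2.length = n} ∩
      (fun y : β × List α => (y.1, fun i : Fin n => y.2.getD i default)) ⁻¹'
        ((fun x : β × (Fin n → α) => f (x.1, List.ofFn x.2)) ⁻¹' s) := by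
    ext ⟨b, l⟩
    have hl : List.ofFn (fun i : Fin l.length => l.getD i default) = l := by
      apply List.ext_getElem <;> simp
    simp [-List.getD_eq_getElem?_getD, hl]
  rw [hU]
  refine MeasurableSet.iUnion fun n => MeasurableSet.inter ?_ (hg n (hf n hs))
  exact (measurable_list_length.comp measurable_snd) (measurableSet_singleton n)

theorem measurable_list_concat [Inhabited α] :
    Measurable fun y : α × List α => y.2 ++ [y.1] := by
  refine measurable_prod_list_of_ofFn fun n => ?_
  have h : (fun x : α × (Fin n → α) => List.ofFn x.2 ++ [x.1])
      = (fun z : Fin (n + 1) → α => List.ofFn z) ∘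
        fun x : α × (Fin n → α) => (Fin.snoc x.2 x.1 : Fin (n + 1) → α) := by
    funext x
    rw [Function.comp_apply, List.ofFn_succ']
    simp [List.concat_eq_append]
  change Measurable fun x : α × (Fin n → α) => List.ofFn x.2 ++ [x.1]
  rw [h]
  refine (measurable_ofFn _).comp (measurable_pi_iff.2 fun i => ?_)
  refine Fin.lastCases ?_ (fun j => ?_) i
  · simpa using measurable_fst
  · have : Measurable fun y : α × (Fin n → α) => y.2 j :=
      (measurable_pi_apply j).comp measurable_snd
    simpa using this

/-- Makes the level sets of the bandit history measurable, as resampling requires. -/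
instance List.measurableSingletonClass [MeasurableSingletonClass α] :
    MeasurableSingletonClass (List α) :=
  ⟨fun l => measurableSet_list_iff.2 fun n => by
    refine Set.Subsingleton.measurableSet ?_
    intro x hx y hy
    exact List.ofFn_injective ((hx : List.ofFn x = l).trans (hy : List.ofFn y = l).symm)⟩

end ListMeasurable

namespace BilateralTrade

theorem Procedure.measurable_price_prod {Obs : Type} [MeasurableSpace Obs] [Inhabited Obs]
    (R : Procedure Obs) : Measurable fun y : R.Seed × List Obs => R.price y.1 y.2 :=
  measurable_prod_list_of_ofFn R.measurable_price

/-! ### One step of the run -/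

section RunStep

variable (R : Procedure Bool) (Q : Procedure (Bool × ℝ)) (T : ℕ) (ωR : R.Seed) (ωQ : Q.Seed)
  (v : ℕ → Pair) (t : ℕ)

theorem posted_eq_ite : posted R Q T ωR ωQ v t =
    if (run R Q T ωR ωQ v t).budget < 1 then R.price ωR (run R Q T ωR ωQ v t).revHist
    else Q.price ωQ (run R Q T ωR ωQ v t).primalHist := by
  rw [posted, State.prices]

theorem run_succ_budget : (run R Q T ωR ωQ v (t + 1)).budget =
    (run R Q T ωR ωQ v t).budget + rev (posted R Q T ωR ωQ v t) (v t) := by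
  rw [run, State.step]; split_ifs <;> rfl

theorem run_succ_lam : (run R Q T ωR ωQ v (t + 1)).lam =
    if (run R Q T ωR ωQ v t).budget < 1 then (run R Q T ωR ωQ v t).lam
    else max 0 (min (dualBound T)
      ((run R Q T ωR ωQ v t).lam - 1 / √(T : ℝ) * rev (posted R Q T ωR ωQ v t) (v t))) := by
  rw [run, State.step]; split_ifs <;> rfl

theorem run_succ_revHist : (run R Q T ωR ωQ v (t + 1)).revHist =
    if (run R Q T ωR ωQ v t).budget < 1 then
      (run R Q T ωR ωQ v t).revHist ++ [trade (posted R Q T ωR ωQ v t) (v t)]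
    else (run R Q T ωR ωQ v t).revHist := by
  rw [run, State.step]; split_ifs <;> rfl

theorem run_succ_primalHist : (run R Q T ωR ωQ v (t + 1)).primalHist =
    if (run R Q T ωR ωQ v t).budget < 1 then (run R Q T ωR ωQ v t).primalHist
    else (run R Q T ωR ωQ v t).primalHist ++
      [(trade (posted R Q T ωR ωQ v t) (v t), (run R Q T ωR ωQ v t).lam)] := by
  rw [run, State.step]; split_ifs <;> rfl

end RunStep

/-! ### Measurability of the run of the algorithm -/

section RunMeasurable

variable (R : Procedure Bool) (Q : Procedure (Bool × ℝ)) (T : ℕ)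

/-- The components are treated together because each update uses the posted prices, which in turn
depend on the budget and both histories. -/
theorem measurable_run_and_posted (t : ℕ) :
    (Measurable fun ω : R.Seed × Q.Seed × (ℕ → Pair) => (run R Q T ω.1 ω.2.1 ω.2.2 t).budget) ∧
    (Measurable fun ω : R.Seed × Q.Seed × (ℕ → Pair) => (run R Q T ω.1 ω.2.1 ω.2.2 t).lam) ∧
    (Measurable fun ω : R.Seed × Q.Seed × (ℕ → Pair) => (run R Q T ω.1 ω.2.1 ω.2.2 t).revHist) ∧
    (Measurable fun ω : R.Seed × Q.Seed × (ℕ → Pair) =>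
      (run R Q T ω.1 ω.2.1 ω.2.2 t).primalHist) ∧
    (Measurable fun ω : R.Seed × Q.Seed × (ℕ → Pair) => posted R Q T ω.1 ω.2.1 ω.2.2 t) := by
  have price : ∀ t,
      (Measurable fun ω : R.Seed × Q.Seed × (ℕ → Pair) =>
        (run R Q T ω.1 ω.2.1 ω.2.2 t).budget) →
      (Measurable fun ω : R.Seed × Q.Seed × (ℕ → Pair) =>
        (run R Q T ω.1 ω.2.1 ω.2.2 t).revHist) →
      (Measurable fun ω : R.Seed × Q.Seed × (ℕ → Pair) =>
        (run R Q T ω.1 ω.2.1 ω.2.2 t).primalHist) →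
      Measurable fun ω : R.Seed × Q.Seed × (ℕ → Pair) => posted R Q T ω.1 ω.2.1 ω.2.2 t := by
    intro t hB hr hp
    simp only [posted_eq_ite]
    exact Measurable.ite (measurableSet_lt hB measurable_const)
      (R.measurable_price_prod.comp (measurable_fst.prodMk hr))
      (Q.measurable_price_prod.comp ((measurable_fst.comp measurable_snd).prodMk hp))
  induction t with
  | zero =>
    have h1 : Measurable fun ω : R.Seed × Q.Seed × (ℕ → Pair) =>
        (run R Q T ω.1 ω.2.1 ω.2.2 0).budget := measurable_const
    have h3 : Measurable fun ω : R.Seed × Q.Seed × (ℕ → Pair) =>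
        (run R Q T ω.1 ω.2.1 ω.2.2 0).revHist := measurable_const
    have h4 : Measurable fun ω : R.Seed × Q.Seed × (ℕ → Pair) =>
        (run R Q T ω.1 ω.2.1 ω.2.2 0).primalHist := measurable_const
    exact ⟨h1, measurable_const, h3, h4, price 0 h1 h3 h4⟩
  | succ t ih =>
    obtain ⟨hB, hl, hr, hp, ha⟩ := ih
    have hv : Measurable fun ω : R.Seed × Q.Seed × (ℕ → Pair) => ω.2.2 t :=
      (measurable_pi_apply t).comp (measurable_snd.comp measurable_snd)
    have hrev : Measurable fun ω : R.Seed × Q.Seed × (ℕ → Pair) =>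
        rev (posted R Q T ω.1 ω.2.1 ω.2.2 t) (ω.2.2 t) := measurable_rev.comp (ha.prodMk hv)
    have htr : Measurable fun ω : R.Seed × Q.Seed × (ℕ → Pair) =>
        trade (posted R Q T ω.1 ω.2.1 ω.2.2 t) (ω.2.2 t) := measurable_trade.comp (ha.prodMk hv)
    have hlt := measurableSet_lt hB (measurable_const (a := (1 : ℝ)))
    have h1 : Measurable fun ω : R.Seed × Q.Seed × (ℕ → Pair) =>
        (run R Q T ω.1 ω.2.1 ω.2.2 (t + 1)).budget := by
      simp only [run_succ_budget]
      exact hB.add hrev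
    have h2 : Measurable fun ω : R.Seed × Q.Seed × (ℕ → Pair) =>
        (run R Q T ω.1 ω.2.1 ω.2.2 (t + 1)).lam := by
      simp only [run_succ_lam]
      exact Measurable.ite hlt hl (measurable_const.max (measurable_const.min
        (hl.sub (hrev.const_mul (1 / √(T : ℝ))))))
    have h3 : Measurable fun ω : R.Seed × Q.Seed × (ℕ → Pair) =>
        (run R Q T ω.1 ω.2.1 ω.2.2 (t + 1)).revHist := by
      simp only [run_succ_revHist]
      exact Measurable.ite hlt (measurable_list_concat.comp (htr.prodMk hr)) hr
    have h4 : Measurable fun ω : R.Seed × Q.Seed × (ℕ → Pair) =>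
        (run R Q T ω.1 ω.2.1 ω.2.2 (t + 1)).primalHist := by
      simp only [run_succ_primalHist]
      exact Measurable.ite hlt hp (measurable_list_concat.comp ((htr.prodMk hl).prodMk hp))
    exact ⟨h1, h2, h3, h4, price _ h1 h3 h4⟩

end RunMeasurable

/-! ### A bandit procedure with multiplicative regret -/

noncomputable section

theorem exp_le_one_add_two_mul {x : ℝ} (h0 : 0 ≤ x) (h1 : x ≤ 1) : Real.exp x ≤ 1 + 2 * x := by
  have := Real.abs_exp_sub_one_sub_id_le (x := x) (by rwa [abs_of_nonneg h0])
  have := (abs_le.1 this).2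
  nlinarith

/-- Giving up half of the linear term removes any quadratic term. This is the source of a
multiplicative rather than additive regret. -/
theorem exp_neg_le_one_sub_half {x : ℝ} (h0 : 0 ≤ x) (h1 : x ≤ 1) :
    Real.exp (-x) ≤ 1 - x / 2 := by
  rw [Real.exp_neg]
  have h2 := Real.quadratic_le_exp_of_nonneg h0
  have h3 : (0 : ℝ) < 1 + x + x ^ 2 / 2 := by positivity
  refine (inv_anti₀ h3 h2).trans ?_
  rw [inv_le_iff_one_le_mul₀ h3]
  nlinarith [mul_nonneg h0 (sub_nonneg.2 h1), mul_nonneg (mul_nonneg h0 h0) (sub_nonneg.2 h1)]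

/-- The history of a bandit whose choice after each history is prescribed by `ω`, when it observes
the bits `l` (oldest first). -/
def playHist {Arm : Type} (ω : List (Arm × Bool) → Arm) (l : List Bool) : List (Arm × Bool) :=
  l.foldl (fun h b => (ω h, b) :: h) []

theorem playHist_concat {Arm : Type} (ω : List (Arm × Bool) → Arm) (l : List Bool) (b : Bool) :
    playHist ω (l ++ [b]) = (ω (playHist ω l), b) :: playHist ω l := by
  simp [playHist]

theorem length_playHist {Arm : Type} (ω : List (Arm × Bool) → Arm) (l : List Bool) :
    (playHist ω l).length = l.length := by
  induction l using List.reverseRecOn with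
  | nil => rfl
  | append_singleton l b ih => rw [playHist_concat]; simp [ih]

/-- Replaying `l` consults the seed only at histories strictly shorter than `l`. -/
theorem playHist_congr {Arm : Type} {ω ω' : List (Arm × Bool) → Arm} (l : List Bool)
    (h : ∀ x : List (Arm × Bool), x.length < l.length → ω' x = ω x) :
    playHist ω' l = playHist ω l := by
  induction l using List.reverseRecOn with
  | nil => rfl
  | append_singleton l b ih =>
    have ih' := ih fun x hx => h x (by simp; omega)
    rw [playHist_concat, playHist_concat, ih', h _ (by simp [length_playHist])]

theorem measurable_eval_prod {Arm : Type} [Fintype Arm] [MeasurableSpace Arm]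
    [MeasurableSingletonClass Arm] :
    Measurable fun y : (List (Arm × Bool) → Arm) × List (Arm × Bool) => y.1 y.2 :=
  measurable_from_prod_countable_left fun h => measurable_pi_apply h

theorem measurable_playHist {Arm : Type} [Fintype Arm] [MeasurableSpace Arm]
    [MeasurableSingletonClass Arm] :
    Measurable fun y : (List (Arm × Bool) → Arm) × List Bool => playHist y.1 y.2 := by
  refine measurable_from_prod_countable_left fun l => ?_
  change Measurable fun ω : List (Arm × Bool) → Arm => playHist ω l
  induction l using List.reverseRecOn with
  | nil => exact measurable_const
  | append_singleton l b ih =>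
    simp only [playHist_concat]
    have h1 : Measurable fun ω : List (Arm × Bool) → Arm => (ω (playHist ω l), playHist ω l) :=
      (measurable_eval_prod.comp (measurable_id.prodMk ih)).prodMk ih
    exact (Measurable.of_discrete (f := fun y : Arm × List (Arm × Bool) => (y.1, b) :: y.2)).comp h1

section Bandit

variable {Arm : Type} [Fintype Arm]

/-- The learning rate of the bandit, which is also its exploration probability per arm. -/
def learnRate (Arm : Type) [Fintype Arm] : ℝ := 1 / (2 * Fintype.card Arm)

/-- Exponential weights of the estimates `g`, mixed half-half with uniform exploration. -/
def armProb (g : Arm → ℝ) (a : Arm) : ℝ :=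
  Real.exp (learnRate Arm * g a) / (2 * ∑ j, Real.exp (learnRate Arm * g j)) + learnRate Arm

section Prob

variable [Nonempty Arm]

theorem learnRate_pos : 0 < learnRate Arm := by
  have : 0 < Fintype.card Arm := Fintype.card_pos
  unfold learnRate
  positivity

theorem weight_sum_pos (g : Arm → ℝ) : 0 < ∑ j, Real.exp (learnRate Arm * g j) :=
  Finset.sum_pos (fun _ _ => Real.exp_pos _) Finset.univ_nonempty

theorem learnRate_le_armProb (g : Arm → ℝ) (a : Arm) : learnRate Arm ≤ armProb g a := by
  have := weight_sum_pos g
  unfold armProb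
  have : 0 ≤ Real.exp (learnRate Arm * g a) / (2 * ∑ j, Real.exp (learnRate Arm * g j)) := by
    positivity
  linarith

theorem armProb_pos (g : Arm → ℝ) (a : Arm) : 0 < armProb g a :=
  learnRate_pos.trans_le (learnRate_le_armProb g a)

theorem sum_armProb (g : Arm → ℝ) : ∑ a, armProb g a = 1 := by
  have h1 := weight_sum_pos g
  have h2 : (0 : ℝ) < Fintype.card Arm := by exact_mod_cast Fintype.card_pos (α := Arm)
  unfold armProb
  rw [Finset.sum_add_distrib, ← Finset.sum_div]
  simp only [Finset.sum_const, Finset.card_univ, nsmul_eq_mul]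
  rw [show learnRate Arm = 1 / (2 * Fintype.card Arm) from rfl] at *
  field_simp
  norm_num

/-- The exploration probability equals the learning rate, so importance-weighted increments stay in
the range where the linear bounds on `exp` apply. -/
theorem learnRate_mul_div_armProb_mem (g : Arm → ℝ) (a : Arm) {r : ℝ} (h0 : 0 ≤ r) (h1 : r ≤ 1) :
    0 ≤ learnRate Arm * (r / armProb g a) ∧ learnRate Arm * (r / armProb g a) ≤ 1 := by
  have hp := armProb_pos g a
  have hr := learnRate_pos (Arm := Arm)
  refine ⟨by positivity, ?_⟩
  rw [← mul_div_assoc, div_le_one hp]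
  calc learnRate Arm * r ≤ learnRate Arm * 1 := by gcongr
    _ ≤ armProb g a := by rw [mul_one]; exact learnRate_le_armProb g a

end Prob

variable [DecidableEq Arm] (pr : Arm → Pair)

/-- The importance-weighted estimates of the cumulative revenues of the arms after a history (newest
observation first). -/
def armEst : List (Arm × Bool) → Arm → ℝ
  | [], _ => 0
  | (a, b) :: h, k => armEst h k +
      if a = k ∧ b = true then (((pr a).2 : ℝ) - (pr a).1) / armProb (armEst h) a else 0

/-- The revenue collected along a history. -/
def histRev : List (Arm × Bool) → ℝ
  | [] => 0
  | (a, b) :: h => histRev h + if b = true then ((pr a).2 : ℝ) - (pr a).1 else 0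

section Potential

variable [Nonempty Arm] {pr}

/-- The exponential potential of the estimates is controlled by the collected revenue. -/
theorem potential_le (hpr : ∀ a, (pr a).1 ≤ (pr a).2) (h : List (Arm × Bool)) :
    ∑ j, Real.exp (learnRate Arm * armEst pr h j)
      ≤ Fintype.card Arm * Real.exp (4 * learnRate Arm * histRev pr h) := by
  induction h with
  | nil => simp [armEst, histRev]
  | cons x h ih =>
    obtain ⟨a, b⟩ := x
    have hr := learnRate_pos (Arm := Arm)
    cases b with
    | false => simpa [armEst, histRev] using ih
    | true =>
      set r : ℝ := ((pr a).2 : ℝ) - (pr a).1 with hrdef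
      have r0 : 0 ≤ r := sub_nonneg.2 (hpr a)
      have r1 : r ≤ 1 := by
        have h1 := (pr a).1.2.1
        have h2 := (pr a).2.2.2
        linarith
      set g := armEst pr h
      set W := ∑ j, Real.exp (learnRate Arm * g j)
      have hW : 0 < W := weight_sum_pos g
      obtain ⟨y0, y1⟩ := learnRate_mul_div_armProb_mem g a r0 r1
      have hp := armProb_pos g a
      have e1 : ∀ j, Real.exp (learnRate Arm * armEst pr ((a, true) :: h) j)
          = Real.exp (learnRate Arm * g j) + if j = a then
            Real.exp (learnRate Arm * g a) * (Real.exp (learnRate Arm * (r / armProb g a)) - 1)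
            else 0 := fun j => by
        have e : armEst pr ((a, true) :: h) j
            = g j + if a = j ∧ true = true then r / armProb g a else 0 := rfl
        rw [e]
        by_cases hj : j = a
        · subst hj
          rw [if_pos ⟨rfl, rfl⟩, if_pos rfl, mul_add, Real.exp_add]
          ring
        · rw [if_neg fun h => hj h.1.symm, if_neg hj, add_zero, add_zero]
      simp only [e1]
      rw [Finset.sum_add_distrib, Finset.sum_ite_eq' Finset.univ a, if_pos (Finset.mem_univ a)]
      have hwp : Real.exp (learnRate Arm * g a) ≤ 2 * W * armProb g a := by
        have h : Real.exp (learnRate Arm * g a) / (2 * W) ≤ armProb g a := by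
          rw [armProb]
          exact le_add_of_nonneg_right hr.le
        rw [div_le_iff₀ (by positivity)] at h
        linarith
      -- Only the weight of the chosen arm changes. Its share of `W` is at most twice its
      -- probability, which cancels the importance weight and leaves the collected revenue.
      have h2 : Real.exp (learnRate Arm * g a) *
          (Real.exp (learnRate Arm * (r / armProb g a)) - 1) ≤ W * (4 * learnRate Arm * r) := by
        calc _ ≤ 2 * W * armProb g a * (2 * (learnRate Arm * (r / armProb g a))) := by
              refine mul_le_mul hwp ?_ ?_ (by positivity)
              · linarith [exp_le_one_add_two_mul y0 y1]
              · linarith [Real.add_one_le_exp (learnRate Arm * (r / armProb g a))]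
          _ = W * (4 * learnRate Arm * r) := by field_simp; ring
      have h3 : histRev pr ((a, true) :: h) = histRev pr h + r := by simp [histRev, r]
      rw [h3, mul_add, Real.exp_add, ← mul_assoc]
      calc W + _ ≤ W * (4 * learnRate Arm * r + 1) := by linarith
        _ ≤ W * Real.exp (4 * learnRate Arm * r) := by
            gcongr
            exact Real.add_one_le_exp _
        _ ≤ _ := by gcongr

theorem learnRate_mul_armEst_le (hpr : ∀ a, (pr a).1 ≤ (pr a).2) (h : List (Arm × Bool)) (k : Arm) :
    learnRate Arm * armEst pr h k
      ≤ Real.log (Fintype.card Arm) + 4 * learnRate Arm * histRev pr h := by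
  have h2 : (0 : ℝ) < Fintype.card Arm := by exact_mod_cast Fintype.card_pos (α := Arm)
  have h1 : Real.exp (learnRate Arm * armEst pr h k)
      ≤ Fintype.card Arm * Real.exp (4 * learnRate Arm * histRev pr h) :=
    (Finset.single_le_sum (f := fun j => Real.exp (learnRate Arm * armEst pr h j))
      (fun _ _ => (Real.exp_pos _).le) (Finset.mem_univ k)).trans (potential_le hpr h)
  have := Real.log_le_log (Real.exp_pos _) h1
  rwa [Real.log_exp, Real.log_mul h2.ne' (Real.exp_pos _).ne', Real.log_exp] at this

end Potential

variable [MeasurableSpace Arm]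

/-- The law of the arm chosen after a history. -/
def armLaw (h : List (Arm × Bool)) : Measure Arm :=
  ∑ a, ENNReal.ofReal (armProb (armEst pr h) a) • Measure.dirac a

theorem lintegral_armLaw [MeasurableSingletonClass Arm] (h : List (Arm × Bool))
    (f : Arm → ENNReal) :
    ∫⁻ a, f a ∂armLaw pr h = ∑ a, ENNReal.ofReal (armProb (armEst pr h) a) * f a := by
  rw [armLaw, lintegral_finsetSum_measure]
  simp [lintegral_smul_measure]

instance [Nonempty Arm] (h : List (Arm × Bool)) : IsProbabilityMeasure (armLaw pr h) := by
  refine ⟨?_⟩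
  simp only [armLaw, Measure.coe_finsetSum, Finset.sum_apply, Measure.smul_apply, measure_univ,
    smul_eq_mul, mul_one]
  rw [← ENNReal.ofReal_sum_of_nonneg fun a _ => (armProb_pos _ a).le, sum_armProb,
    ENNReal.ofReal_one]

variable [MeasurableSingletonClass Arm] [Nonempty Arm]

/-- The bandit as a pricing procedure with one-bit feedback: the seed prescribes the arm to choose
after each history. -/
abbrev banditProcedure : Procedure Bool where
  Seed := List (Arm × Bool) → Arm
  measSeed := inferInstance
  law := Measure.infinitePi (armLaw pr)
  isProb := inferInstance
  price ω l := pr (ω (playHist ω l))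
  measurable_price n := by
    refine (Measurable.of_discrete (f := pr)).comp (measurable_eval_prod.comp
      (measurable_fst.prodMk (measurable_playHist.comp (measurable_fst.prodMk
        ((measurable_ofFn n).comp measurable_snd)))))

end Bandit

end

/-! ### Dependence of the run on seeds and valuations -/

/-- The run sees only past valuations, and sees the Rev-Max seed only in the rounds where Rev-Max is
called. Both resampling arguments rest on this. -/
theorem run_congr {R : Procedure Bool} {Q : Procedure (Bool × ℝ)} {T : ℕ} {ωR ωR' : R.Seed}
    {ωQ : Q.Seed} {v v' : ℕ → Pair} (t : ℕ)
    (hv : ∀ s < t, v' s = v s)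
    (hR : ∀ s < t, (run R Q T ωR ωQ v s).budget < 1 →
      R.price ωR' (run R Q T ωR ωQ v s).revHist = R.price ωR (run R Q T ωR ωQ v s).revHist) :
    run R Q T ωR' ωQ v' t = run R Q T ωR ωQ v t := by
  induction t with
  | zero => rfl
  | succ t ih =>
    have ih' := ih (fun s hs => hv s (by omega)) fun s hs => hR s (by omega)
    have hp : (run R Q T ωR ωQ v t).prices R Q ωR' ωQ = (run R Q T ωR ωQ v t).prices R Q ωR ωQ := by
      simp only [State.prices]
      split_ifs with h
      · exact hR t (by omega) h
      · rfl
    rw [run, run, ih', hv t (by omega), State.step, State.step, hp]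

theorem length_revHist_mono (R : Procedure Bool) (Q : Procedure (Bool × ℝ)) (T : ℕ) (ωR : R.Seed)
    (ωQ : Q.Seed) (v : ℕ → Pair) :
    Monotone fun t => (run R Q T ωR ωQ v t).revHist.length := by
  refine monotone_nat_of_le_succ fun t => ?_
  rw [run_succ_revHist]
  split_ifs <;> simp

/-! ### Integrals with respect to the joint law -/

section JointLaw

variable {R : Procedure Bool} {Q : Procedure (Bool × ℝ)} {L : ℕ → ProbabilityMeasure Pair}
  {f : R.Seed × Q.Seed × (ℕ → Pair) → ENNReal}

/-- Tonelli with the Rev-Max seed innermost, so that the concentration of the estimates may be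
proved for fixed valuations and primal seed. -/
theorem lintegral_jointLaw_le_one_of_seed (hf : Measurable f)
    (h : ∀ ωQ v, ∫⁻ ωR, f (ωR, ωQ, v) ∂(R.law) ≤ 1) : ∫⁻ ω, f ω ∂jointLaw R Q L ≤ 1 := by
  rw [jointLaw, lintegral_prod_symm' f hf]
  calc _ ≤ ∫⁻ _, 1 ∂(Q.law.prod (Measure.infinitePi fun t => (L t : Measure Pair))) :=
        lintegral_mono fun y => h y.1 y.2
    _ = 1 := by simp

theorem lintegral_jointLaw_le_one_of_valuations (hf : Measurable f)
    (h : ∀ ωR ωQ, ∫⁻ v, f (ωR, ωQ, v) ∂Measure.infinitePi (fun t => (L t : Measure Pair)) ≤ 1) :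
    ∫⁻ ω, f ω ∂jointLaw R Q L ≤ 1 := by
  rw [jointLaw, lintegral_prod f hf.aemeasurable]
  calc _ ≤ ∫⁻ _, 1 ∂(R.law) := by
        refine lintegral_mono fun ωR => ?_
        rw [lintegral_prod (fun y => f (ωR, y)) (hf.comp measurable_prodMk_left).aemeasurable]
        calc _ ≤ ∫⁻ _, 1 ∂Q.law := lintegral_mono fun ωQ => h ωR ωQ
          _ = 1 := by simp
    _ = 1 := by simp

end JointLaw

/-! ### Concentration of the estimates of the bandit -/

noncomputable section

variable {Arm : Type} [Fintype Arm] [DecidableEq Arm] [Nonempty Arm] (pr : Arm → Pair)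

/-- One round of the exponent that compares half of the revenue of arm `k` with its estimate. -/
def estGapStep (h : List (Arm × Bool)) (k a : Arm) (x : Pair) : ℝ :=
  learnRate Arm * (rev (pr k) x / 2 -
    if a = k then rev (pr k) x / armProb (armEst pr h) k else 0)

variable {pr}

/-- With `y = θ r / 2`, the sum is at most `exp y * (1 - y) ≤ 1`: the estimate is used with
probability `p k`, and `exp_neg_le_one_sub_half` turns its contribution into `-y`. Halving the true
revenue is what closes the inequality. -/
theorem sum_armProb_mul_exp_le (hpr : ∀ a, (pr a).1 ≤ (pr a).2) (h : List (Arm × Bool)) (k : Arm)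
    (x : Pair) : ∑ a, armProb (armEst pr h) a * Real.exp (estGapStep pr h k a x) ≤ 1 := by
  set p := armProb (armEst pr h)
  set r := rev (pr k) x
  have r0 : 0 ≤ r := rev_nonneg_of_le (hpr k) x
  have r1 : r ≤ 1 := (abs_le.1 (abs_rev_le_one (pr k) x)).2
  obtain ⟨y0, y1⟩ := learnRate_mul_div_armProb_mem (armEst pr h) k r0 r1
  have hp : 0 < p k := armProb_pos _ k
  set θ := learnRate Arm
  have hsplit : ∀ a, p a * Real.exp (estGapStep pr h k a x) = Real.exp (θ * r / 2) *
      (p a + if a = k then p k * (Real.exp (-(θ * (r / p k))) - 1) else 0) := fun a => by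
    by_cases ha : a = k
    · subst ha
      rw [if_pos rfl, estGapStep, if_pos rfl]
      change p a * Real.exp (θ * (r / 2 - r / p a)) = _
      rw [show θ * (r / 2 - r / p a) = θ * r / 2 + -(θ * (r / p a)) by ring, Real.exp_add]
      ring
    · rw [if_neg ha, estGapStep, if_neg ha]
      change p a * Real.exp (θ * (r / 2 - 0)) = _
      rw [show θ * (r / 2 - 0) = θ * r / 2 by ring]
      ring
  simp only [hsplit]
  rw [← Finset.mul_sum, Finset.sum_add_distrib, Finset.sum_ite_eq' Finset.univ k,
    if_pos (Finset.mem_univ k), sum_armProb]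
  have h1 : p k * (Real.exp (-(θ * (r / p k))) - 1) ≤ p k * (-(θ * (r / p k)) / 2) := by
    gcongr
    linarith [exp_neg_le_one_sub_half y0 y1]
  have h2 : p k * (-(θ * (r / p k)) / 2) = -(θ * r / 2) := by
    field_simp
  calc _ ≤ Real.exp (θ * r / 2) * (-(θ * r / 2) + 1) :=
        mul_le_mul_of_nonneg_left (by linarith) (Real.exp_pos _).le
    _ ≤ Real.exp (θ * r / 2) * Real.exp (-(θ * r / 2)) := by
        gcongr
        exact Real.add_one_le_exp _
    _ = 1 := by rw [← Real.exp_add]; simp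

variable [MeasurableSpace Arm] [MeasurableSingletonClass Arm] (pr)
  (Q : Procedure (Bool × ℝ)) (T : ℕ)

/-- The internal history of the bandit before round `t`. -/
def banditHist (ω : List (Arm × Bool) → Arm) (ωQ : Q.Seed) (v : ℕ → Pair) (t : ℕ) :
    List (Arm × Bool) :=
  playHist ω (run (banditProcedure pr) Q T ω ωQ v t).revHist

/-- The exponent that compares half of the cumulative revenue of arm `k` over the rounds of the
bandit with its estimate. -/
def estGap (k : Arm) (ω : List (Arm × Bool) → Arm) (ωQ : Q.Seed) (v : ℕ → Pair) (t : ℕ) : ℝ :=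
  ∑ s ∈ Finset.range t, if (run (banditProcedure pr) Q T ω ωQ v s).budget < 1 then
    estGapStep pr (banditHist pr Q T ω ωQ v s) k (ω (banditHist pr Q T ω ωQ v s)) (v s) else 0

theorem banditHist_succ (ω : List (Arm × Bool) → Arm) (ωQ : Q.Seed) (v : ℕ → Pair) (t : ℕ) :
    banditHist pr Q T ω ωQ v (t + 1) =
      if (run (banditProcedure pr) Q T ω ωQ v t).budget < 1 then
        (ω (banditHist pr Q T ω ωQ v t),
          trade (pr (ω (banditHist pr Q T ω ωQ v t))) (v t)) :: banditHist pr Q T ω ωQ v t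
      else banditHist pr Q T ω ωQ v t := by
  rw [banditHist, run_succ_revHist]
  split_ifs with h
  · rw [playHist_concat, posted_eq_ite, if_pos h]
    rfl
  · rfl

-- The estimate grows only when arm `k` is played and trades, and then by exactly the
-- importance-weighted revenue, so the increments telescope.
theorem estGap_eq (k : Arm) (ω : List (Arm × Bool) → Arm) (ωQ : Q.Seed) (v : ℕ → Pair) (t : ℕ) :
    estGap pr Q T k ω ωQ v t = learnRate Arm *
      ((∑ s ∈ Finset.range t, if (run (banditProcedure pr) Q T ω ωQ v s).budget < 1 then
        rev (pr k) (v s) else 0) / 2 - armEst pr (banditHist pr Q T ω ωQ v t) k) := by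
  induction t with
  | zero => simp [estGap, banditHist, run, State.init, playHist, armEst]
  | succ t ih =>
    rw [estGap, Finset.sum_range_succ, ← estGap, ih, Finset.sum_range_succ, banditHist_succ]
    split_ifs with h
    · set H := banditHist pr Q T ω ωQ v t
      have e : armEst pr ((ω H, trade (pr (ω H)) (v t)) :: H) k = armEst pr H k +
          if ω H = k then rev (pr k) (v t) / armProb (armEst pr H) k else 0 := by
        rw [armEst]
        by_cases hk : ω H = k
        · subst hk
          by_cases ht : trade (pr (ω H)) (v t) = true
          · rw [if_pos ⟨rfl, ht⟩, if_pos rfl, rev, if_pos ht]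
          · rw [if_neg fun h => ht h.2, if_pos rfl, rev, if_neg ht, zero_div]
        · rw [if_neg fun h => hk h.1, if_neg hk]
      rw [e, estGapStep]
      ring
    · ring

theorem histRev_banditHist (ω : List (Arm × Bool) → Arm) (ωQ : Q.Seed) (v : ℕ → Pair) (t : ℕ) :
    histRev pr (banditHist pr Q T ω ωQ v t) =
      ∑ s ∈ Finset.range t, if (run (banditProcedure pr) Q T ω ωQ v s).budget < 1 then
        rev (posted (banditProcedure pr) Q T ω ωQ v s) (v s) else 0 := by
  induction t with
  | zero => simp [banditHist, run, State.init, playHist, histRev]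
  | succ t ih =>
    rw [Finset.sum_range_succ, ← ih, banditHist_succ]
    split_ifs with h
    · rw [histRev, posted_eq_ite, if_pos h]
      rfl
    · rw [add_zero]

/-- Every Rev-Max round lengthens the history by one, so the choices made before round `t` were read
off at strictly shorter histories than the modified one. -/
theorem run_update_seed (ω : List (Arm × Bool) → Arm) (ωQ : Q.Seed) (v : ℕ → Pair) {s t : ℕ}
    (hst : s ≤ t) (a : Arm) :
    run (banditProcedure pr) Q T (Function.update ω (banditHist pr Q T ω ωQ v t) a) ωQ v s
      = run (banditProcedure pr) Q T ω ωQ v s := by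
  refine run_congr s (fun _ _ => rfl) fun i hi hb => ?_
  set H := banditHist pr Q T ω ωQ v t
  set l := (run (banditProcedure pr) Q T ω ωQ v i).revHist
  have hl : l.length < H.length := by
    have h1 : l.length < (run (banditProcedure pr) Q T ω ωQ v (i + 1)).revHist.length := by
      rw [run_succ_revHist, if_pos hb]
      simp [l]
    have h2 := length_revHist_mono (banditProcedure pr) Q T ω ωQ v (show i + 1 ≤ t by omega)
    have h3 : H.length = (run (banditProcedure pr) Q T ω ωQ v t).revHist.length :=
      length_playHist _ _
    rw [h3]
    exact h1.trans_le h2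
  change pr (Function.update ω H a (playHist (Function.update ω H a) l)) = pr (ω (playHist ω l))
  have hu : ∀ x : List (Arm × Bool), x.length < H.length → Function.update ω H a x = ω x :=
    fun x hx => Function.update_of_ne (fun h => by rw [h] at hx; exact lt_irrefl _ hx) _ _
  rw [playHist_congr l fun x hx => hu x (hx.trans hl), hu _ (by rwa [length_playHist])]

theorem banditHist_update_seed (ω : List (Arm × Bool) → Arm) (ωQ : Q.Seed) (v : ℕ → Pair) {s t : ℕ}
    (hst : s ≤ t) (a : Arm) :
    banditHist pr Q T (Function.update ω (banditHist pr Q T ω ωQ v t) a) ωQ v s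
      = banditHist pr Q T ω ωQ v s := by
  rw [banditHist, run_update_seed pr Q T ω ωQ v hst a, banditHist]
  refine playHist_congr _ fun x hx => Function.update_of_ne (fun h => ?_) _ _
  have h1 := length_revHist_mono (banditProcedure pr) Q T ω ωQ v hst
  have h2 : x.length = (run (banditProcedure pr) Q T ω ωQ v t).revHist.length := by
    rw [h]; exact length_playHist _ _
  exact absurd hx (by rw [h2]; exact not_lt.2 h1)

theorem measurable_banditHist (t : ℕ) :
    Measurable fun ω : (banditProcedure pr).Seed × Q.Seed × (ℕ → Pair) =>
      banditHist pr Q T ω.1 ω.2.1 ω.2.2 t :=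
  measurable_playHist.comp
    (measurable_fst.prodMk (measurable_run_and_posted (banditProcedure pr) Q T t).2.2.1)

theorem measurable_estGapStep (k : Arm) (t : ℕ) :
    Measurable fun ω : (banditProcedure pr).Seed × Q.Seed × (ℕ → Pair) =>
      if (run (banditProcedure pr) Q T ω.1 ω.2.1 ω.2.2 t).budget < 1 then
        estGapStep pr (banditHist pr Q T ω.1 ω.2.1 ω.2.2 t) k
          (ω.1 (banditHist pr Q T ω.1 ω.2.1 ω.2.2 t)) (ω.2.2 t) else 0 := by
  have hh := measurable_banditHist pr Q T t
  have ha : Measurable fun ω : (banditProcedure pr).Seed × Q.Seed × (ℕ → Pair) =>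
      ω.1 (banditHist pr Q T ω.1 ω.2.1 ω.2.2 t) :=
    measurable_eval_prod.comp (measurable_fst.prodMk hh)
  have hv : Measurable fun ω : (banditProcedure pr).Seed × Q.Seed × (ℕ → Pair) => ω.2.2 t :=
    (measurable_pi_apply t).comp (measurable_snd.comp measurable_snd)
  have hg : Measurable fun y : Pair × (List (Arm × Bool) × Arm) => estGapStep pr y.2.1 k y.2.2 y.1 := by
    refine measurable_from_prod_countable_left fun y => ?_
    have hr : Measurable fun x : Pair => rev (pr k) x := measurable_rev.comp measurable_prodMk_left
    dsimp only [estGapStep]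
    split_ifs
    · exact ((hr.div_const _).sub (hr.div_const _)).const_mul _
    · exact ((hr.div_const _).sub measurable_const).const_mul _
  exact Measurable.ite
    (measurableSet_lt (measurable_run_and_posted (banditProcedure pr) Q T t).1 measurable_const)
    (hg.comp (hv.prodMk (hh.prodMk ha))) measurable_const

theorem measurable_estGap (k : Arm) (t : ℕ) :
    Measurable fun ω : (banditProcedure pr).Seed × Q.Seed × (ℕ → Pair) =>
      estGap pr Q T k ω.1 ω.2.1 ω.2.2 t :=
  Finset.measurable_sum _ fun s _ => measurable_estGapStep pr Q T k s

variable {pr}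

/-- A supermartingale argument without filtrations: the arm of round `t` is the seed coordinate at
the current history, and resampling it multiplies by a factor of mean at most one. -/
theorem lintegral_exp_estGap_le (hpr : ∀ a, (pr a).1 ≤ (pr a).2) (k : Arm) (ωQ : Q.Seed)
    (v : ℕ → Pair) (t : ℕ) :
    ∫⁻ ω, ENNReal.ofReal (Real.exp (estGap pr Q T k ω ωQ v t)) ∂(banditProcedure pr).law ≤ 1 := by
  have slice : Measurable fun ω : (banditProcedure pr).Seed => (ω, ωQ, v) := measurable_prodMk_right
  induction t with
  | zero => simp [estGap]
  | succ t ih =>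
    refine le_trans ?_ ih
    have e : ∀ ω : (banditProcedure pr).Seed,
        ENNReal.ofReal (Real.exp (estGap pr Q T k ω ωQ v (t + 1)))
        = ENNReal.ofReal (Real.exp (estGap pr Q T k ω ωQ v t)) * ENNReal.ofReal (Real.exp
          (if (run (banditProcedure pr) Q T ω ωQ v t).budget < 1 then
            estGapStep pr (banditHist pr Q T ω ωQ v t) k (ω (banditHist pr Q T ω ωQ v t)) (v t)
          else 0)) := fun ω => by
      rw [← ENNReal.ofReal_mul (Real.exp_pos _).le, ← Real.exp_add, estGap, Finset.sum_range_succ,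
        ← estGap]
    simp only [e]
    refine lintegral_mul_le_of_resample (armLaw pr) (H := fun ω => banditHist pr Q T ω ωQ v t)
      (Real.measurable_exp.comp ((measurable_estGap pr Q T k t).comp slice)).ennreal_ofReal
      (Real.measurable_exp.comp ((measurable_estGapStep pr Q T k t).comp slice)).ennreal_ofReal
      (fun h => ((measurable_banditHist pr Q T t).comp slice) (measurableSet_singleton h))
      (fun ω a => banditHist_update_seed pr Q T ω ωQ v le_rfl a) (fun ω a => ?_) fun ω => ?_
    -- The closed form depends on the seed only through the states before `t` and the history at
    -- `t`, all unaffected by the update.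
    · rw [estGap_eq, estGap_eq, banditHist_update_seed pr Q T ω ωQ v le_rfl a]
      congr 5
      refine Finset.sum_congr rfl fun s hs => ?_
      rw [run_update_seed pr Q T ω ωQ v (Finset.mem_range.1 hs).le a]
    · simp only [run_update_seed pr Q T ω ωQ v le_rfl, banditHist_update_seed pr Q T ω ωQ v le_rfl,
        Function.update_self]
      split_ifs with h
      · rw [lintegral_armLaw]
        simp only [← ENNReal.ofReal_mul (armProb_pos _ _).le]
        rw [← ENNReal.ofReal_sum_of_nonneg fun a _ =>
          mul_nonneg (armProb_pos _ a).le (Real.exp_pos _).le]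
        exact ENNReal.ofReal_le_one.2 (sum_armProb_mul_exp_le hpr _ k (v t))
      · simp

/-- With high probability, the revenue of every arm over the rounds of the bandit is at most eight
times the revenue of the bandit, up to an additive term. -/
theorem jointLaw_bandit_regret (hpr : ∀ a, (pr a).1 ≤ (pr a).2) (L : ℕ → ProbabilityMeasure Pair)
    (hT : 1 ≤ T) :
    jointLaw (banditProcedure pr) Q L {ω | ¬ ∀ k,
      (∑ s ∈ Finset.range T, if (run (banditProcedure pr) Q T ω.1 ω.2.1 ω.2.2 s).budget < 1 then
        rev (pr k) (ω.2.2 s) else 0)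
      ≤ 8 * (∑ s ∈ Finset.range T,
          if (run (banditProcedure pr) Q T ω.1 ω.2.1 ω.2.2 s).budget < 1 then
            rev (posted (banditProcedure pr) Q T ω.1 ω.2.1 ω.2.2 s) (ω.2.2 s) else 0)
        + 4 * Fintype.card Arm * (Real.log (Fintype.card Arm) + Real.log (Fintype.card Arm * T))}
      ≤ ENNReal.ofReal (1 / T) := by
  set n : ℝ := (Fintype.card Arm : ℝ) with hn
  have hn0 : 0 < n := Nat.cast_pos.2 Fintype.card_pos
  have hT0 : (0 : ℝ) < T := by exact_mod_cast hT
  have hbad : ∀ k, jointLaw (banditProcedure pr) Q L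
      {ω | Real.log (n * T) < estGap pr Q T k ω.1 ω.2.1 ω.2.2 T} ≤ ENNReal.ofReal (1 / (n * T)) := by
    intro k
    refine measure_log_lt_le (measurable_estGap pr Q T k T) ?_ (by positivity)
    exact lintegral_jointLaw_le_one_of_seed
      (Real.measurable_exp.comp (measurable_estGap pr Q T k T)).ennreal_ofReal
      fun ωQ v => lintegral_exp_estGap_le Q T hpr k ωQ v T
  calc _ ≤ jointLaw (banditProcedure pr) Q L
        (⋃ k, {ω | Real.log (n * T) < estGap pr Q T k ω.1 ω.2.1 ω.2.2 T}) := by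
        refine measure_mono fun ω hω => ?_
        by_contra hgood
        refine hω fun k => ?_
        have h1 : estGap pr Q T k ω.1 ω.2.1 ω.2.2 T ≤ Real.log (n * T) := by
          by_contra hlt
          exact hgood (Set.mem_iUnion.2 ⟨k, not_le.1 hlt⟩)
        rw [estGap_eq] at h1
        have h2 := learnRate_mul_armEst_le hpr (banditHist pr Q T ω.1 ω.2.1 ω.2.2 T) k
        rw [histRev_banditHist] at h2
        set G := ∑ s ∈ Finset.range T,
          if (run (banditProcedure pr) Q T ω.1 ω.2.1 ω.2.2 s).budget < 1 then
            rev (pr k) (ω.2.2 s) else 0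
        set S := ∑ s ∈ Finset.range T,
          if (run (banditProcedure pr) Q T ω.1 ω.2.1 ω.2.2 s).budget < 1 then
            rev (posted (banditProcedure pr) Q T ω.1 ω.2.1 ω.2.2 s) (ω.2.2 s) else 0
        have hl : learnRate Arm * (2 * n) = 1 := by
          rw [learnRate, ← hn]; field_simp
        set θ := learnRate Arm
        rw [← hn] at h2
        have h3 : θ * (G / 2) - 4 * θ * S ≤ Real.log n + Real.log (n * T) := by linarith
        -- Since `2 n θ = 1`, multiplying by `4 n` normalizes the coefficient of `G` to `1` and
        -- turns that of `S` into `8`.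
        have h4 := mul_le_mul_of_nonneg_left h3 (by positivity : 0 ≤ 4 * n)
        have h5 : 4 * n * (θ * (G / 2) - 4 * θ * S) = (θ * (2 * n)) * (G - 8 * S) := by ring
        rw [h5, hl] at h4
        linarith
    _ ≤ ∑ k, jointLaw (banditProcedure pr) Q L
        {ω | Real.log (n * T) < estGap pr Q T k ω.1 ω.2.1 ω.2.2 T} := by
        simpa using measure_iUnion_fintype_le (jointLaw (banditProcedure pr) Q L) _
    _ ≤ ∑ _k : Arm, ENNReal.ofReal (1 / (n * T)) := Finset.sum_le_sum fun k _ => hbad k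
    _ = ENNReal.ofReal (1 / T) := by
        rw [Finset.sum_const, Finset.card_univ, nsmul_eq_mul, ← ENNReal.ofReal_natCast, ← hn,
          ← ENNReal.ofReal_mul hn0.le]
        congr 1
        field_simp

end

/-- The exponential form of Hoeffding's lemma for a function bounded by `B`. -/
theorem lintegral_exp_mean_sub_le {X : Type*} [MeasurableSpace X] {ν : Measure X}
    [IsProbabilityMeasure ν] {f : X → ℝ} (hf : Measurable f) {B : ℝ} (hB : ∀ x, |f x| ≤ B)
    (s : ℝ) :
    ∫⁻ x, ENNReal.ofReal (Real.exp (s * ((∫ y, f y ∂ν) - f x) - s ^ 2 * B ^ 2 / 2)) ∂ν ≤ 1 := by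
  have hsub := ProbabilityTheory.hasSubgaussianMGF_of_mem_Icc (μ := ν) hf.aemeasurable
    (Filter.Eventually.of_forall fun x => abs_le.1 (hB x))
  have h1 := hsub.mgf_le (-s)
  have h2 := hsub.integrable_exp_mul (-s)
  have e : ∀ x, Real.exp (s * ((∫ y, f y ∂ν) - f x) - s ^ 2 * B ^ 2 / 2)
      = Real.exp (-(s ^ 2 * B ^ 2 / 2)) * Real.exp (-s * (f x - ∫ y, f y ∂ν)) := fun x => by
    rw [← Real.exp_add]; ring_nf
  simp only [e]
  rw [← ofReal_integral_eq_lintegral_ofReal (h2.const_mul _)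
    (Filter.Eventually.of_forall fun x => by positivity), integral_const_mul]
  refine ENNReal.ofReal_le_one.2 ?_
  have h3 : ((‖B - -B‖₊ / 2 : NNReal) ^ 2 : NNReal) = B ^ 2 := by
    push_cast
    rw [Real.norm_eq_abs, div_pow, sq_abs]
    ring
  have h4 : ∫ x, Real.exp (-s * (f x - ∫ y, f y ∂ν)) ∂ν ≤ Real.exp (s ^ 2 * B ^ 2 / 2) := by
    refine h1.trans (le_of_eq ?_)
    rw [h3]
    ring_nf
  calc _ ≤ Real.exp (-(s ^ 2 * B ^ 2 / 2)) * Real.exp (s ^ 2 * B ^ 2 / 2) := by gcongr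
    _ = 1 := by rw [← Real.exp_add]; simp

noncomputable section

variable (R : Procedure Bool) (Q : Procedure (Bool × ℝ)) (T : ℕ)

/-! ### The weights of the revenue constraint -/

theorem dualBound_nonneg (T : ℕ) : 0 ≤ dualBound T :=
  mul_nonneg (by norm_num) (Real.log_natCast_nonneg T)

theorem run_lam_mem (ωR : R.Seed) (ωQ : Q.Seed) (v : ℕ → Pair) (t : ℕ) :
    0 ≤ (run R Q T ωR ωQ v t).lam ∧ (run R Q T ωR ωQ v t).lam ≤ dualBound T := by
  induction t with
  | zero => exact ⟨le_rfl, dualBound_nonneg T⟩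
  | succ t ih =>
    rw [run_succ_lam]
    split_ifs
    · exact ih
    · exact ⟨le_max_left _ _, max_le (dualBound_nonneg T) (min_le_left _ _)⟩

/-- The weight of the revenue in a round: `1` in the rounds of Rev-Max and the multiplier in the
others. -/
def revWeight (ωR : R.Seed) (ωQ : Q.Seed) (v : ℕ → Pair) (t : ℕ) : ℝ :=
  if (run R Q T ωR ωQ v t).budget < 1 then 1 else (run R Q T ωR ωQ v t).lam

variable {T} in
theorem revWeight_mem (hT : 1 ≤ dualBound T) (ωR : R.Seed) (ωQ : Q.Seed) (v : ℕ → Pair) (t : ℕ) :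
    0 ≤ revWeight R Q T ωR ωQ v t ∧ revWeight R Q T ωR ωQ v t ≤ dualBound T := by
  unfold revWeight
  split_ifs
  · exact ⟨zero_le_one, hT⟩
  · exact run_lam_mem R Q T ωR ωQ v t

theorem measurable_revWeight (t : ℕ) : Measurable fun ω : R.Seed × Q.Seed × (ℕ → Pair) =>
    revWeight R Q T ω.1 ω.2.1 ω.2.2 t := by
  obtain ⟨hB, hl, -⟩ := measurable_run_and_posted R Q T t
  exact Measurable.ite (measurableSet_lt hB measurable_const) measurable_const hl

/-! ### Concentration of the weighted reward of a policy -/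

variable (π : ProbabilityMeasure Pair) (L : ℕ → ProbabilityMeasure Pair)

/-- The excess of the expected weighted reward of the policy `π` in round `t` over the realized
one. -/
def rewardGap (ωR : R.Seed) (ωQ : Q.Seed) (v : ℕ → Pair) (t : ℕ) : ℝ :=
  (expGft π (L t) + revWeight R Q T ωR ωQ v t * expRev π (L t)) -
    (polGft π (v t) + revWeight R Q T ωR ωQ v t * polRev π (v t))

theorem measurable_rewardGap (t : ℕ) : Measurable fun ω : R.Seed × Q.Seed × (ℕ → Pair) =>
    rewardGap R Q T π L ω.1 ω.2.1 ω.2.2 t := by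
  have hw := measurable_revWeight R Q T t
  have hv : Measurable fun ω : R.Seed × Q.Seed × (ℕ → Pair) => ω.2.2 t :=
    (measurable_pi_apply t).comp (measurable_snd.comp measurable_snd)
  exact ((hw.mul_const _).const_add _).sub
    (((measurable_polGft π).comp hv).add (hw.mul ((measurable_polRev π).comp hv)))

/-- The compensated exponent of the accumulated reward gaps. -/
def gapExponent (s : ℝ) (ωR : R.Seed) (ωQ : Q.Seed) (v : ℕ → Pair) (t : ℕ) : ℝ :=
  ∑ i ∈ Finset.range t, (s * rewardGap R Q T π L ωR ωQ v i - s ^ 2 * (1 + dualBound T) ^ 2 / 2)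

theorem measurable_gapExponent (s : ℝ) (t : ℕ) :
    Measurable fun ω : R.Seed × Q.Seed × (ℕ → Pair) =>
      gapExponent R Q T π L s ω.1 ω.2.1 ω.2.2 t :=
  Finset.measurable_sum _ fun i _ => ((measurable_rewardGap R Q T π L i).const_mul s).sub_const _

variable {T}

/-- The weight of round `t` is determined by the seeds and earlier valuations. Once these are fixed,
the gap is the mean of a function bounded by `1 + M` minus its value at a fresh draw, and
Hoeffding's lemma applies. -/
theorem lintegral_exp_gapExponent_le (hT : 1 ≤ dualBound T) (s : ℝ) (ωR : R.Seed) (ωQ : Q.Seed)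
    (t : ℕ) :
    ∫⁻ v, ENNReal.ofReal (Real.exp (gapExponent R Q T π L s ωR ωQ v t))
      ∂Measure.infinitePi (fun t => (L t : Measure Pair)) ≤ 1 := by
  have slice : Measurable fun v : ℕ → Pair => (ωR, ωQ, v) :=
    measurable_prodMk_left.comp measurable_prodMk_left
  induction t with
  | zero => simp [gapExponent]
  | succ t ih =>
    have hupd : ∀ (v : ℕ → Pair) (x : Pair) (i : ℕ), i ≤ t →
        revWeight R Q T ωR ωQ (Function.update v t x) i = revWeight R Q T ωR ωQ v i := by
      intro v x i hi
      rw [revWeight, revWeight, run_congr i (fun j hj => Function.update_of_ne (show j ≠ t by omega) _ _)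
        fun _ _ _ => rfl]
    refine le_trans ?_ ih
    have e : ∀ v, ENNReal.ofReal (Real.exp (gapExponent R Q T π L s ωR ωQ v (t + 1)))
        = ENNReal.ofReal (Real.exp (gapExponent R Q T π L s ωR ωQ v t)) * ENNReal.ofReal (Real.exp
          (s * rewardGap R Q T π L ωR ωQ v t - s ^ 2 * (1 + dualBound T) ^ 2 / 2)) := fun v => by
      rw [← ENNReal.ofReal_mul (Real.exp_pos _).le, ← Real.exp_add, gapExponent,
        Finset.sum_range_succ, ← gapExponent]
    simp only [e]
    refine lintegral_mul_le_of_resample (fun t => (L t : Measure Pair)) (H := fun _ => t)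
      (Real.measurable_exp.comp ((measurable_gapExponent R Q T π L s t).comp slice)).ennreal_ofReal
      (Real.measurable_exp.comp ((((measurable_rewardGap R Q T π L t).const_mul s).sub_const
        _).comp slice)).ennreal_ofReal
      (fun _ => .const _) (fun _ _ => rfl) (fun v x => ?_) fun v => ?_
    · have : gapExponent R Q T π L s ωR ωQ (Function.update v t x) t
          = gapExponent R Q T π L s ωR ωQ v t := by
        refine Finset.sum_congr rfl fun i hi => ?_
        have hi' := Finset.mem_range.1 hi
        rw [rewardGap, rewardGap, hupd v x i hi'.le, Function.update_of_ne hi'.ne]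
      simp only [this]
    · set c := revWeight R Q T ωR ωQ v t
      obtain ⟨c0, c1⟩ : 0 ≤ c ∧ c ≤ dualBound T := revWeight_mem R Q hT ωR ωQ v t
      set f : Pair → ℝ := fun x => polGft π x + c * polRev π x with hf
      have hfm : Measurable f := (measurable_polGft π).add ((measurable_polRev π).const_mul c)
      have hfB : ∀ x, |f x| ≤ 1 + dualBound T := fun x => by
        refine (abs_add_le _ _).trans (add_le_add (abs_polGft_le_one π x) ?_)
        rw [abs_mul, abs_of_nonneg c0]
        calc c * |polRev π x| ≤ dualBound T * 1 :=
              mul_le_mul c1 (abs_polRev_le_one π x) (abs_nonneg _) (c0.trans c1)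
          _ = dualBound T := mul_one _
      have hint : ∫ y, f y ∂(L t : Measure Pair) = expGft π (L t) + c * expRev π (L t) := by
        rw [hf, integral_add (integrable_of_abs_le (measurable_polGft π) (abs_polGft_le_one π))
          ((integrable_of_abs_le (measurable_polRev π) (abs_polRev_le_one π)).const_mul c),
          integral_const_mul]
        rfl
      have := lintegral_exp_mean_sub_le (ν := (L t : Measure Pair)) hfm hfB s
      refine le_of_eq_of_le (lintegral_congr fun x => ?_) this
      rw [rewardGap, hupd v x t le_rfl, Function.update_self, hint]

/-- With high probability, the realized weighted reward of a fixed policy is not much smaller than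
the expected one. -/
theorem jointLaw_rewardGap (hM : 1 ≤ dualBound T) (hT : 1 ≤ T) :
    jointLaw R Q L {ω | ¬ ∑ t ∈ Finset.range T, rewardGap R Q T π L ω.1 ω.2.1 ω.2.2 t
      ≤ (1 + dualBound T) * √T * (1 + Real.log T)} ≤ ENNReal.ofReal (1 / T) := by
  have hT0 : (0 : ℝ) < T := by exact_mod_cast hT
  set B := 1 + dualBound T with hB
  have hB0 : 0 < B := by linarith
  have hs0 : 0 < √(T : ℝ) := Real.sqrt_pos.2 hT0
  -- With this scale the compensator accumulated over `T` rounds is exactly `1 / 2`.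
  set s := 1 / (B * √(T : ℝ)) with hs
  have hpos : 0 < s := by positivity
  refine le_trans (measure_mono fun ω hω => ?_)
    (measure_log_lt_le (measurable_gapExponent R Q T π L s T)
      (lintegral_jointLaw_le_one_of_valuations
        (Real.measurable_exp.comp (measurable_gapExponent R Q T π L s T)).ennreal_ofReal
        fun ωR ωQ => lintegral_exp_gapExponent_le R Q π L hM s ωR ωQ T) hT0)
  change Real.log T < gapExponent R Q T π L s ω.1 ω.2.1 ω.2.2 T
  have h1 : B * √T * (1 + Real.log T)
      < ∑ t ∈ Finset.range T, rewardGap R Q T π L ω.1 ω.2.1 ω.2.2 t := not_le.1 hω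
  rw [gapExponent, Finset.sum_sub_distrib, ← Finset.mul_sum, Finset.sum_const, Finset.card_range,
    nsmul_eq_mul, ← hB]
  have h2 := mul_lt_mul_of_pos_left h1 hpos
  have h3 : s * (B * √T * (1 + Real.log T)) = 1 + Real.log T := by
    rw [hs]; field_simp
  have h4 : (T : ℝ) * (s ^ 2 * B ^ 2 / 2) = 1 / 2 := by
    rw [hs, div_pow, mul_pow, Real.sq_sqrt hT0.le]
    field_simp
  linarith

end

/-! ### Pathwise analysis of the algorithm -/

section Pathwise

variable {R : Procedure Bool} (Q : Procedure (Bool × ℝ)) (T : ℕ) (ωR : R.Seed) (ωQ : Q.Seed)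
  (v : ℕ → Pair)

theorem posted_le_of_budget_lt (hR : NoSubsidy R) {t : ℕ}
    (h : (run R Q T ωR ωQ v t).budget < 1) :
    (posted R Q T ωR ωQ v t).1 ≤ (posted R Q T ωR ωQ v t).2 := by
  rw [posted_eq_ite, if_pos h]
  exact hR _ _

theorem budget_eq_sum (t : ℕ) : (run R Q T ωR ωQ v t).budget
    = ∑ s ∈ Finset.range t, rev (posted R Q T ωR ωQ v s) (v s) := by
  induction t with
  | zero => rfl
  | succ t ih => rw [run_succ_budget, Finset.sum_range_succ, ih]

theorem mem_pdRounds {t : ℕ} : t ∈ pdRounds R Q T ωR ωQ v ↔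
    t < T ∧ ¬ (run R Q T ωR ωQ v t).budget < 1 := by
  simp [pdRounds]

theorem card_pdRounds_le : (pdRounds R Q T ωR ωQ v).card ≤ T := by
  rw [pdRounds]
  exact (Finset.card_filter_le _ _).trans (Finset.card_range T).le

theorem sum_range_eq_add_pdRounds (f : ℕ → ℝ) : ∑ t ∈ Finset.range T, f t =
    (∑ t ∈ Finset.range T, if (run R Q T ωR ωQ v t).budget < 1 then f t else 0) +
      ∑ t ∈ pdRounds R Q T ωR ωQ v, f t := by
  rw [pdRounds, ← Finset.sum_filter]
  convert (Finset.sum_filter_add_sum_filter_not (Finset.range T)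
    (fun t => (run R Q T ωR ωQ v t).budget < 1) f).symm using 2

theorem bddAbove_dualRegret : BddAbove {r | ∃ t₁ t₂ : ℕ, t₁ ≤ t₂ ∧ t₂ < T ∧
    ∃ μ ∈ Set.Icc 0 (dualBound T), r = ∑ t ∈ pdRounds R Q T ωR ωQ v ∩ Finset.Icc t₁ t₂,
      ((run R Q T ωR ωQ v t).lam - μ) * rev (posted R Q T ωR ωQ v t) (v t)} := by
  refine ⟨T * dualBound T, ?_⟩
  rintro r ⟨t₁, t₂, -, -, μ, hμ, rfl⟩
  have hM := dualBound_nonneg T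
  calc _ ≤ ∑ t ∈ pdRounds R Q T ωR ωQ v ∩ Finset.Icc t₁ t₂, dualBound T := by
        refine Finset.sum_le_sum fun t _ => ?_
        obtain ⟨h0, h1⟩ := run_lam_mem R Q T ωR ωQ v t
        have h2 : |(run R Q T ωR ωQ v t).lam - μ| ≤ dualBound T := by
          rw [abs_le]; constructor <;> linarith [hμ.1, hμ.2]
        refine (le_abs_self _).trans ?_
        rw [abs_mul]
        exact (mul_le_mul h2 (abs_rev_le_one _ _) (abs_nonneg _) hM).trans (mul_one _).le
    _ ≤ T * dualBound T := by
        rw [Finset.sum_const, nsmul_eq_mul]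
        gcongr
        exact (Finset.card_le_card Finset.inter_subset_left).trans (card_pdRounds_le Q T ωR ωQ v)

theorem sum_le_dualRegret {t₁ t₂ : ℕ} (h1 : t₁ ≤ t₂) (h2 : t₂ < T) {μ : ℝ}
    (hμ : μ ∈ Set.Icc 0 (dualBound T)) :
    ∑ t ∈ pdRounds R Q T ωR ωQ v ∩ Finset.Icc t₁ t₂,
      ((run R Q T ωR ωQ v t).lam - μ) * rev (posted R Q T ωR ωQ v t) (v t)
      ≤ dualRegret R Q T ωR ωQ v :=
  le_csSup (bddAbove_dualRegret Q T ωR ωQ v) ⟨t₁, t₂, h1, h2, μ, hμ, rfl⟩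

theorem budget_zero_lt : (run R Q T ωR ωQ v 0).budget < 1 := zero_lt_one

theorem dualRegret_nonneg (hT : 1 ≤ T) : 0 ≤ dualRegret R Q T ωR ωQ v := by
  have h := sum_le_dualRegret Q T ωR ωQ v le_rfl (show 0 < T by omega)
    (Set.left_mem_Icc.2 (dualBound_nonneg T))
  -- Round `0` always belongs to Rev-Max, so this interval contributes an empty sum.
  have he : pdRounds R Q T ωR ωQ v ∩ Finset.Icc 0 0 = ∅ := by
    refine Finset.eq_empty_of_forall_notMem fun t ht => ?_
    rw [Finset.mem_inter, mem_pdRounds, Finset.mem_Icc] at ht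
    obtain ⟨⟨-, h1⟩, h2⟩ := ht
    obtain rfl : t = 0 := by omega
    exact h1 (budget_zero_lt Q T ωR ωQ v)
  rwa [he, Finset.sum_empty] at h

/-- The dual regret bounds the penalty paid by the primal procedure; the revenue of Rev-Max is
credited at the maximal multiplier. -/
theorem sum_lam_mul_rev_le (hT : 1 ≤ T) :
    ∑ t ∈ pdRounds R Q T ωR ωQ v,
      (run R Q T ωR ωQ v t).lam * rev (posted R Q T ωR ωQ v t) (v t)
    ≤ 2 * dualRegret R Q T ωR ωQ v + 2 * dualBound T - dualBound T *
      ∑ t ∈ Finset.range T, if (run R Q T ωR ωQ v t).budget < 1 then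
        rev (posted R Q T ωR ωQ v t) (v t) else 0 := by
  have hM := dualBound_nonneg T
  set ρ : ℕ → ℝ := fun t => rev (posted R Q T ωR ωQ v t) (v t) with hρ
  set l : ℕ → ℝ := fun t => (run R Q T ωR ωQ v t).lam with hl
  set pd := pdRounds R Q T ωR ωQ v with hpd
  set A := (Finset.range T).filter fun t => (run R Q T ωR ωQ v t).budget < 1 with hA
  have h0 : 0 ∈ A := Finset.mem_filter.2 ⟨Finset.mem_range.2 (by omega), budget_zero_lt Q T ωR ωQ v⟩
  -- The last Rev-Max round. The budget is below `1` before it, hence at most `2` after it, and all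
  -- Rev-Max revenue has been collected by then.
  set m := A.max' ⟨0, h0⟩ with hm
  obtain ⟨hmT, hmB⟩ := Finset.mem_filter.1 (A.max'_mem ⟨0, h0⟩)
  rw [← hm] at hmT hmB
  rw [Finset.mem_range] at hmT
  have hle : ∀ t ∈ A, t ≤ m := fun t ht => A.le_max' t ht
  rw [← Finset.sum_filter]
  have hsplit : ∑ t ∈ A, ρ t + ∑ t ∈ pd ∩ Finset.Icc 0 m, ρ t ≤ 2 := by
    have h1 : (run R Q T ωR ωQ v (m + 1)).budget ≤ 2 := by
      rw [run_succ_budget]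
      linarith [(abs_le.1 (abs_rev_le_one (posted R Q T ωR ωQ v m) (v m))).2]
    rw [budget_eq_sum] at h1
    rw [← Finset.sum_union]
    · refine le_of_eq_of_le (Finset.sum_congr ?_ fun _ _ => rfl) h1
      ext t
      simp only [Finset.mem_union, Finset.mem_inter, Finset.mem_Icc, Finset.mem_range, hpd,
        mem_pdRounds]
      constructor
      · rintro (h | h)
        · exact Nat.lt_succ_of_le (hle t h)
        · omega
      · intro h
        by_cases hb : (run R Q T ωR ωQ v t).budget < 1
        · exact Or.inl (Finset.mem_filter.2 ⟨Finset.mem_range.2 (by omega), hb⟩)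
        · exact Or.inr ⟨⟨by omega, hb⟩, by omega, by omega⟩
    · refine Finset.disjoint_left.2 fun t h1 h2 => ?_
      rw [Finset.mem_inter, hpd, mem_pdRounds] at h2
      exact h2.1.2 (Finset.mem_filter.1 h1).2
  have hpart : ∑ t ∈ pd, l t * ρ t = ∑ t ∈ pd ∩ Finset.Icc 0 m, l t * ρ t
      + ∑ t ∈ pd ∩ Finset.Icc (m + 1) (T - 1), l t * ρ t := by
    rw [← Finset.sum_union]
    · refine Finset.sum_congr ?_ fun _ _ => rfl
      ext t
      simp only [Finset.mem_union, Finset.mem_inter, Finset.mem_Icc]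
      constructor
      · intro h
        have := ((mem_pdRounds Q T ωR ωQ v).1 h).1
        by_cases hb : t ≤ m
        · exact Or.inl ⟨h, by omega, hb⟩
        · exact Or.inr ⟨h, by omega, by omega⟩
      · rintro (h | h) <;> exact h.1
    · refine Finset.disjoint_left.2 fun t h1 h2 => ?_
      simp only [Finset.mem_inter, Finset.mem_Icc] at h1 h2
      omega
  have hfirst : ∑ t ∈ pd ∩ Finset.Icc 0 m, l t * ρ t
      ≤ dualRegret R Q T ωR ωQ v + dualBound T * ∑ t ∈ pd ∩ Finset.Icc 0 m, ρ t := by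
    -- Up to `m` the comparator is the maximal multiplier `M`; after `m` it is `0`. Two intervals
    -- give two copies of the dual regret.
    have := sum_le_dualRegret Q T ωR ωQ v (Nat.zero_le m) hmT (Set.right_mem_Icc.2 hM)
    have e : ∑ t ∈ pd ∩ Finset.Icc 0 m, (l t - dualBound T) * ρ t
        = ∑ t ∈ pd ∩ Finset.Icc 0 m, l t * ρ t
          - dualBound T * ∑ t ∈ pd ∩ Finset.Icc 0 m, ρ t := by
      rw [Finset.mul_sum, ← Finset.sum_sub_distrib]
      exact Finset.sum_congr rfl fun t _ => sub_mul _ _ _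
    linarith
  have hsecond : ∑ t ∈ pd ∩ Finset.Icc (m + 1) (T - 1), l t * ρ t ≤ dualRegret R Q T ωR ωQ v := by
    by_cases h : m + 1 ≤ T - 1
    · simpa using sum_le_dualRegret Q T ωR ωQ v h (by omega) (Set.left_mem_Icc.2 hM)
    · rw [Finset.Icc_eq_empty h, Finset.inter_empty, Finset.sum_empty]
      exact dualRegret_nonneg Q T ωR ωQ v hT
  have := mul_le_mul_of_nonneg_left hsplit hM
  change ∑ t ∈ pd, l t * ρ t ≤ 2 * dualRegret R Q T ωR ωQ v + 2 * dualBound T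
    - dualBound T * ∑ t ∈ A, ρ t
  rw [hpart]
  linarith

theorem sum_le_primalRegret {K : ℕ} {π : ProbabilityMeasure Pair} (hπ : π ∈ gridPolicies K) :
    ∑ t ∈ pdRounds R Q T ωR ωQ v,
      ((polGft π (v t) + (run R Q T ωR ωQ v t).lam * polRev π (v t)) -
        (gft (posted R Q T ωR ωQ v t) (v t) +
          (run R Q T ωR ωQ v t).lam * rev (posted R Q T ωR ωQ v t) (v t)))
      ≤ primalRegret R Q T ωR ωQ K v := by
  refine le_csSup ⟨T * (2 + 2 * dualBound T), ?_⟩ ⟨π, hπ, rfl⟩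
  rintro r ⟨π', -, rfl⟩
  have hM := dualBound_nonneg T
  calc _ ≤ ∑ _t ∈ pdRounds R Q T ωR ωQ v, (2 + 2 * dualBound T) := by
        refine Finset.sum_le_sum fun t _ => ?_
        obtain ⟨h0, h1⟩ := run_lam_mem R Q T ωR ωQ v t
        have h2 := (abs_le.1 (abs_polGft_le_one π' (v t))).2
        have h3 := (abs_le.1 (abs_polRev_le_one π' (v t))).2
        have h4 := (abs_le.1 (abs_gft_le_one (posted R Q T ωR ωQ v t) (v t))).1
        have h5 := (abs_le.1 (abs_rev_le_one (posted R Q T ωR ωQ v t) (v t))).1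
        have h6 := mul_le_mul_of_nonneg_left h3 h0
        have h7 := mul_le_mul_of_nonneg_left h5 h0
        linarith
    _ ≤ T * (2 + 2 * dualBound T) := by
        rw [Finset.sum_const, nsmul_eq_mul]
        gcongr
        exact card_pdRounds_le Q T ωR ωQ v

/-- The reward of a grid policy, penalized by its weighted revenue, against the algorithm. -/
theorem sum_expGft_add_le (hR : NoSubsidy R) (hT : 1 ≤ T) {K : ℕ} {π : ProbabilityMeasure Pair}
    (hπ : π ∈ gridPolicies K) (L : ℕ → ProbabilityMeasure Pair) {H D : ℝ}
    (hH : ∑ t ∈ Finset.range T, rewardGap R Q T π L ωR ωQ v t ≤ H)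
    (hD : ∀ p, (∑ t ∈ Finset.range T, if (run R Q T ωR ωQ v t).budget < 1 then
      gft (p, p) (v t) else 0) ≤ D) :
    ∑ t ∈ Finset.range T, expGft π (L t)
      + ∑ t ∈ Finset.range T, revWeight R Q T ωR ωQ v t * expRev π (L t)
    ≤ totalGft R Q T ωR ωQ v + primalRegret R Q T ωR ωQ K v + 2 * dualRegret R Q T ωR ωQ v
      + 2 * dualBound T - dualBound T * (∑ t ∈ Finset.range T,
        if (run R Q T ωR ωQ v t).budget < 1 then rev (posted R Q T ωR ωQ v t) (v t) else 0)
      + 2 * D + H := by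
  have hprimal := sum_le_primalRegret Q T ωR ωQ v hπ
  have hdual := sum_lam_mul_rev_le Q T ωR ωQ v hT
  have hgap : ∑ t ∈ Finset.range T, rewardGap R Q T π L ωR ωQ v t =
      ∑ t ∈ Finset.range T, expGft π (L t)
      + ∑ t ∈ Finset.range T, revWeight R Q T ωR ωQ v t * expRev π (L t)
      - ∑ t ∈ Finset.range T,
        (polGft π (v t) + revWeight R Q T ωR ωQ v t * polRev π (v t)) := by
    rw [← Finset.sum_add_distrib, ← Finset.sum_sub_distrib]
    rfl
  have hreal := sum_range_eq_add_pdRounds Q T ωR ωQ v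
    fun t => polGft π (v t) + revWeight R Q T ωR ωQ v t * polRev π (v t)
  have h1 : (∑ t ∈ Finset.range T, if (run R Q T ωR ωQ v t).budget < 1 then
      polGft π (v t) + revWeight R Q T ωR ωQ v t * polRev π (v t) else 0) ≤ 2 * D := by
    rw [← Finset.sum_filter]
    refine le_of_eq_of_le (Finset.sum_congr rfl fun t ht => ?_)
      (polGft_add_polRev_sum_le π ((Finset.range T).filter fun t =>
        (run R Q T ωR ωQ v t).budget < 1) v fun p => ?_)
    · rw [revWeight, if_pos (Finset.mem_filter.1 ht).2, one_mul]
    · rw [Finset.sum_filter]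
      exact hD p
  have h2 : ∑ t ∈ pdRounds R Q T ωR ωQ v,
      (polGft π (v t) + revWeight R Q T ωR ωQ v t * polRev π (v t))
      = ∑ t ∈ pdRounds R Q T ωR ωQ v,
        (polGft π (v t) + (run R Q T ωR ωQ v t).lam * polRev π (v t)) := by
    refine Finset.sum_congr rfl fun t ht => ?_
    rw [revWeight, if_neg ((mem_pdRounds Q T ωR ωQ v).1 ht).2]
  -- The Rev-Max rounds can be dropped because prices with `p ≤ q` never yield a negative gain from
  -- trade.
  have h3 : ∑ t ∈ pdRounds R Q T ωR ωQ v, gft (posted R Q T ωR ωQ v t) (v t)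
      ≤ totalGft R Q T ωR ωQ v := by
    rw [totalGft, sum_range_eq_add_pdRounds Q T ωR ωQ v]
    refine le_add_of_nonneg_left (Finset.sum_nonneg fun t _ => ?_)
    split_ifs with h
    · exact gft_nonneg_of_le (posted_le_of_budget_lt Q T ωR ωQ v hR h) _
    · exact le_rfl
  rw [Finset.sum_sub_distrib, Finset.sum_add_distrib (f := fun t =>
    gft (posted R Q T ωR ωQ v t) (v t))] at hprimal
  linarith

end Pathwise

noncomputable section

/-! ### Price pairs with dyadic markups -/

/-- A dyadic truncation of a number, counted from below. -/
theorem le_sum_two_pow_add_one (n : ℕ) (z : ℝ) (hz : z ≤ 2 ^ n) :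
    z ≤ (∑ j ∈ Finset.range n, if (2 : ℝ) ^ j ≤ z then (2 : ℝ) ^ j else 0) + 1 := by
  induction n generalizing z with
  | zero => simpa using hz
  | succ n ih =>
    rw [Finset.sum_range_succ]
    rcases le_total z (2 ^ n) with h | h
    · have := ih z h
      have h0 : (0 : ℝ) ≤ if (2 : ℝ) ^ n ≤ z then (2 : ℝ) ^ n else 0 := by split_ifs <;> positivity
      linarith
    · have h1 := ih (2 ^ n) le_rfl
      -- Above `2 ^ n` all the lower powers are present and cover `2 ^ n` up to `1`; the new term
      -- covers the rest.
      have h2 : (∑ j ∈ Finset.range n, if (2 : ℝ) ^ j ≤ 2 ^ n then (2 : ℝ) ^ j else 0)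
          ≤ ∑ j ∈ Finset.range n, if (2 : ℝ) ^ j ≤ z then (2 : ℝ) ^ j else 0 := by
        refine Finset.sum_le_sum fun j _ => ?_
        split_ifs with h3 h4
        · exact le_rfl
        · exact absurd (h3.trans h) h4
        · positivity
        · exact le_rfl
      rw [if_pos h]
      rw [pow_succ] at hz
      linarith

/-- The arms of Rev-Max: a multiple of `2⁻ᴶ` as one of the two prices, a dyadic markup, and the
choice of the price that the multiple is used for. -/
abbrev PriceArm (J : ℕ) : Type := Fin (2 ^ J + 1) × Fin (J + 1) × Bool

/-- The closest point of the unit interval. -/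
def clamp (x : ℝ) : unitInterval := Set.projIcc 0 1 zero_le_one x

theorem clamp_of_mem {x : ℝ} (h0 : 0 ≤ x) (h1 : x ≤ 1) : (clamp x : ℝ) = x := by
  rw [clamp, Set.projIcc_of_mem zero_le_one ⟨h0, h1⟩]

/-- The prices posted for an arm. -/
def armPrice (J : ℕ) : PriceArm J → Pair
  | (i, j, true) => (clamp ((i : ℝ) / 2 ^ J), clamp ((i : ℝ) / 2 ^ J + 2 ^ (j : ℕ) / 2 ^ J))
  | (i, j, false) => (clamp ((i : ℝ) / 2 ^ J - 2 ^ (j : ℕ) / 2 ^ J), clamp ((i : ℝ) / 2 ^ J))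

theorem armPrice_le (J : ℕ) (a : PriceArm J) : (armPrice J a).1 ≤ (armPrice J a).2 := by
  obtain ⟨i, j, b⟩ := a
  cases b
  · refine Set.monotone_projIcc zero_le_one ?_
    have : (0 : ℝ) ≤ 2 ^ (j : ℕ) / 2 ^ J := by positivity
    linarith
  · refine Set.monotone_projIcc zero_le_one ?_
    have : (0 : ℝ) ≤ 2 ^ (j : ℕ) / 2 ^ J := by positivity
    linarith

/-- The dyadic truncation rescaled by `2 ^ J`. Here `f j` stands for the revenue of the arm with
markup `2^j / 2^J`, which trades whenever the markup fits into `y`. -/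
theorem le_sum_markups (J : ℕ) {y : ℝ} (hy : y ≤ 1) {f : Fin (J + 1) → ℝ} (hf0 : ∀ j, 0 ≤ f j)
    (hf : ∀ j : Fin (J + 1), (2 : ℝ) ^ (j : ℕ) / 2 ^ J ≤ y → f j = 2 ^ (j : ℕ) / 2 ^ J) :
    y ≤ ∑ j, f j + 1 / 2 ^ J := by
  have hN : (0 : ℝ) < 2 ^ J := by positivity
  have h1 := le_sum_two_pow_add_one (J + 1) (y * 2 ^ J) (by
    rw [pow_succ]; nlinarith)
  rw [Finset.sum_range fun j => if (2 : ℝ) ^ j ≤ y * 2 ^ J then (2 : ℝ) ^ j else 0] at h1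
  have h2 : ∑ j : Fin (J + 1), (if (2 : ℝ) ^ (j : ℕ) ≤ y * 2 ^ J then (2 : ℝ) ^ (j : ℕ) else 0)
      ≤ (∑ j, f j) * 2 ^ J := by
    rw [Finset.sum_mul]
    refine Finset.sum_le_sum fun j _ => ?_
    split_ifs with h
    · rw [hf j ((div_le_iff₀ hN).2 h), div_mul_cancel₀ _ hN.ne']
    · exact mul_nonneg (hf0 j) hN.le
  have h3 : y * 2 ^ J ≤ (∑ j, f j + 1 / 2 ^ J) * 2 ^ J := by
    rw [add_mul, one_div, inv_mul_cancel₀ hN.ne']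
    linarith
  exact le_of_mul_le_mul_right h3 hN

/-- The gain from trade of a fixed price is covered by the revenues of the arms with markups just
above and just below it. -/
theorem exists_gft_le_sum_rev (J : ℕ) (p : unitInterval) : ∃ i₁ i₂ : Fin (2 ^ J + 1), ∀ x : Pair,
    gft (p, p) x ≤ ∑ j, rev (armPrice J (i₁, j, true)) x + ∑ j, rev (armPrice J (i₂, j, false)) x
      + 4 / 2 ^ J := by
  have hN : (0 : ℝ) < 2 ^ J := by positivity
  have p0 := p.2.1
  have p1 := p.2.2
  have hpN : (p : ℝ) * 2 ^ J ≤ (2 ^ J : ℕ) := by push_cast; nlinarith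
  have hpN0 : 0 ≤ (p : ℝ) * 2 ^ J := by positivity
  have hc : ⌈(p : ℝ) * 2 ^ J⌉₊ ≤ 2 ^ J := Nat.ceil_le.2 hpN
  have hfl : ⌊(p : ℝ) * 2 ^ J⌋₊ ≤ 2 ^ J := (Nat.floor_le_ceil _).trans hc
  refine ⟨⟨_, Nat.lt_succ_of_le hc⟩, ⟨_, Nat.lt_succ_of_le hfl⟩, fun x => ?_⟩
  -- Rounding up for the seller price and down for the buyer price keeps `s ≤ g` and `h ≤ b`
  -- whenever `p` trades.
  set g : ℝ := (⌈(p : ℝ) * 2 ^ J⌉₊ : ℝ) / 2 ^ J with hg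
  set h : ℝ := (⌊(p : ℝ) * 2 ^ J⌋₊ : ℝ) / 2 ^ J with hh
  have g1 : (p : ℝ) ≤ g := (le_div_iff₀ hN).2 (Nat.le_ceil _)
  have g2 : g ≤ p + 1 / 2 ^ J := by
    rw [hg, div_le_iff₀ hN, add_mul, one_div, inv_mul_cancel₀ hN.ne']
    exact (Nat.ceil_lt_add_one hpN0).le
  have g3 : g ≤ 1 := (div_le_one hN).2 (by exact_mod_cast hc)
  have h1 : h ≤ p := (div_le_iff₀ hN).2 (Nat.floor_le hpN0)
  have h2 : (p : ℝ) ≤ h + 1 / 2 ^ J := by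
    rw [hh, ← add_div, le_div_iff₀ hN]
    exact (Nat.lt_floor_add_one _).le
  have h0 : 0 ≤ h := by positivity
  have n1 : ∀ a : PriceArm J, 0 ≤ rev (armPrice J a) x := fun a =>
    rev_nonneg_of_le (armPrice_le J a) x
  have s0 := x.1.2.1
  have b1 := x.2.2.2
  have e4 : (4 : ℝ) / 2 ^ J = 4 * (1 / 2 ^ J) := by ring
  have hN' : (0 : ℝ) < 1 / 2 ^ J := by positivity
  by_cases ht : (x.1 : ℝ) ≤ p ∧ (p : ℝ) ≤ x.2
  · rw [gft_of_trade (a := (p, p)) ht]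
    have hup := le_sum_markups J (y := (x.2 : ℝ) - g) (by linarith)
      (f := fun j => rev (armPrice J (⟨_, Nat.lt_succ_of_le hc⟩, j, true)) x) (fun j => n1 _)
      fun j hj => by
        have hw : (0 : ℝ) ≤ 2 ^ (j : ℕ) / 2 ^ J := by positivity
        have c1 : ((armPrice J (⟨_, Nat.lt_succ_of_le hc⟩, j, true)).1 : ℝ) = g :=
          clamp_of_mem (p0.trans g1) g3
        have c2 : ((armPrice J (⟨_, Nat.lt_succ_of_le hc⟩, j, true)).2 : ℝ)
            = g + 2 ^ (j : ℕ) / 2 ^ J := clamp_of_mem (by linarith) (by linarith)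
        rw [rev_of_trade (by rw [c1, c2]; constructor <;> linarith [ht.1]), c1, c2]
        ring
    have hdown := le_sum_markups J (y := h - (x.1 : ℝ)) (by linarith)
      (f := fun j => rev (armPrice J (⟨_, Nat.lt_succ_of_le hfl⟩, j, false)) x) (fun j => n1 _)
      fun j hj => by
        have hw : (0 : ℝ) ≤ 2 ^ (j : ℕ) / 2 ^ J := by positivity
        have c1 : ((armPrice J (⟨_, Nat.lt_succ_of_le hfl⟩, j, false)).1 : ℝ)
            = h - 2 ^ (j : ℕ) / 2 ^ J := clamp_of_mem (by linarith) (by linarith)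
        have c2 : ((armPrice J (⟨_, Nat.lt_succ_of_le hfl⟩, j, false)).2 : ℝ) = h :=
          clamp_of_mem h0 (h1.trans p1)
        rw [rev_of_trade (by rw [c1, c2]; constructor <;> linarith [ht.2]), c1, c2]
        ring
    -- `b - s = (b - g) + (g - h) + (h - s)`: the middle part is at most `2 / 2^J` and each
    -- truncation loses `1 / 2^J`.
    linarith
  · rw [gft_of_not_trade (a := (p, p)) ht]
    have m1 := Finset.sum_nonneg fun j (_ : j ∈ Finset.univ) =>
      n1 (⟨_, Nat.lt_succ_of_le hc⟩, j, true)
    have m2 := Finset.sum_nonneg fun j (_ : j ∈ Finset.univ) =>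
      n1 (⟨_, Nat.lt_succ_of_le hfl⟩, j, false)
    linarith

/-- If the revenue of every arm over some rounds is bounded, then so is the gain from trade of every
fixed price. -/
theorem sum_gft_le_of_sum_rev_le (J : ℕ) (s : Finset ℕ) (v : ℕ → Pair) {Y : ℝ}
    (hY : ∀ a, ∑ t ∈ s, rev (armPrice J a) (v t) ≤ Y) (p : unitInterval) :
    ∑ t ∈ s, gft (p, p) (v t) ≤ 2 * (J + 1) * Y + s.card * (4 / 2 ^ J) := by
  obtain ⟨i₁, i₂, h⟩ := exists_gft_le_sum_rev J p
  have side : ∀ (i : Fin (2 ^ J + 1)) (b : Bool),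
      ∑ t ∈ s, ∑ j, rev (armPrice J (i, j, b)) (v t) ≤ (J + 1) * Y := fun i b => by
    rw [Finset.sum_comm]
    simpa using Finset.sum_le_sum fun j (_ : j ∈ (Finset.univ : Finset (Fin (J + 1)))) =>
      hY (i, j, b)
  calc _ ≤ ∑ t ∈ s, (∑ j, rev (armPrice J (i₁, j, true)) (v t)
        + ∑ j, rev (armPrice J (i₂, j, false)) (v t) + 4 / 2 ^ J) :=
        Finset.sum_le_sum fun t _ => h (v t)
    _ ≤ 2 * (J + 1) * Y + s.card * (4 / 2 ^ J) := by
        rw [Finset.sum_add_distrib, Finset.sum_add_distrib, Finset.sum_const, nsmul_eq_mul]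
        linarith [side i₁ true, side i₂ false]

/-- Rev-Max for the horizon `T`. -/
abbrev revMax (T : ℕ) : Procedure Bool := banditProcedure (armPrice (Nat.log 2 T / 4))

theorem revMax_noSubsidy (T : ℕ) : NoSubsidy (revMax T) := fun _ _ => armPrice_le _ _

end

/-! ### The size of the error terms -/

section Numerics

variable {T : ℕ}

theorem two_pow_log_div_four_le (hT : 1 ≤ T) :
    (2 : ℝ) ^ (Nat.log 2 T / 4) ≤ (T : ℝ) ^ (1 / 4 : ℝ) := by
  have h1 : (2 ^ (Nat.log 2 T / 4)) ^ 4 ≤ T := by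
    rw [← pow_mul]
    exact (Nat.pow_le_pow_right (by norm_num) (Nat.div_mul_le_self _ _)).trans
      (Nat.pow_log_le_self 2 (by omega))
  have h2 : ((2 : ℝ) ^ (Nat.log 2 T / 4)) ^ 4 ≤ ((T : ℝ) ^ (1 / 4 : ℝ)) ^ 4 := by
    rw [← Real.rpow_mul_natCast (Nat.cast_nonneg T)]
    norm_num
    exact_mod_cast h1
  exact le_of_pow_le_pow_left₀ (by norm_num) (by positivity) h2

theorem le_two_mul_two_pow_log_div_four :
    (T : ℝ) ^ (1 / 4 : ℝ) ≤ 2 * 2 ^ (Nat.log 2 T / 4) := by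
  have h1 : T ≤ (2 * 2 ^ (Nat.log 2 T / 4)) ^ 4 := by
    rw [← pow_succ', ← pow_mul]
    refine (Nat.lt_pow_succ_log_self one_lt_two T).le.trans
      (Nat.pow_le_pow_right (by norm_num) ?_)
    omega
  have h2 : ((T : ℝ) ^ (1 / 4 : ℝ)) ^ 4 ≤ (2 * (2 : ℝ) ^ (Nat.log 2 T / 4)) ^ 4 := by
    rw [← Real.rpow_mul_natCast (Nat.cast_nonneg T)]
    norm_num
    exact_mod_cast h1
  exact le_of_pow_le_pow_left₀ (by norm_num) (by positivity) h2

/-- Uses `4 log 2 > 5/2`. The margin over `2` leaves room for `32 (J + 1) ≤ 16 log T`. -/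
theorem log_div_four_le (hT : 1 ≤ T) :
    5 / 2 * ((Nat.log 2 T / 4 : ℕ) : ℝ) ≤ Real.log T := by
  have h1 : 2 ^ (4 * (Nat.log 2 T / 4)) ≤ T :=
    (Nat.pow_le_pow_right (by norm_num) (Nat.mul_div_le _ _)).trans
      (Nat.pow_log_le_self 2 (by omega))
  have h2 : ((2 : ℝ) ^ (4 * (Nat.log 2 T / 4))) ≤ T := by exact_mod_cast h1
  have h3 := Real.log_le_log (by positivity) h2
  rw [Real.log_pow] at h3
  push_cast at h3
  have h4 := Real.log_two_gt_d9
  have h5 : (0 : ℝ) ≤ ((Nat.log 2 T / 4 : ℕ) : ℝ) := Nat.cast_nonneg _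
  nlinarith

theorem ten_le_log (hT : 2 ^ 15 ≤ T) : 10 ≤ Real.log T := by
  have h2 : ((2 : ℝ) ^ 15) ≤ T := by exact_mod_cast hT
  have h3 := Real.log_le_log (by positivity) h2
  rw [Real.log_pow] at h3
  have h4 := Real.log_two_gt_d9
  push_cast at h3
  linarith

/-- Everything is expressed through `q = T^{1/4}` and `x = 1 + log T`. The four terms contribute `32
+ 320 + 16 + 16 = 384`; only the discretization term really has order `q ^ 3`. -/
theorem error_terms_le (hT : 1 ≤ T) {J : ℕ} (hJ : J = Nat.log 2 T / 4) {n : ℝ}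
    (hn : n = (2 ^ J + 1) * ((J + 1) * 2)) :
    2 * dualBound T + 4 * (J + 1) * (4 * n * (Real.log n + Real.log (n * T))) + 8 * T / 2 ^ J
      + (1 + dualBound T) * √T * (1 + Real.log T)
    ≤ 384 * (T : ℝ) ^ (3 / 4 : ℝ) * (1 + Real.log T) ^ 3 := by
  set q : ℝ := (T : ℝ) ^ (1 / 4 : ℝ) with hq
  have hT0 : (0 : ℝ) ≤ T := Nat.cast_nonneg T
  have hT1 : (1 : ℝ) ≤ T := by exact_mod_cast hT
  have hq1 : 1 ≤ q := Real.one_le_rpow hT1 (by norm_num)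
  have eT : (T : ℝ) = q ^ 4 := by
    rw [hq, ← Real.rpow_mul_natCast hT0]; norm_num
  have e3 : (T : ℝ) ^ (3 / 4 : ℝ) = q ^ 3 := by
    rw [hq, ← Real.rpow_mul_natCast hT0]; norm_num
  have e2 : √(T : ℝ) = q ^ 2 := by
    rw [Real.sqrt_eq_iff_mul_self_eq hT0 (by positivity), eT]; ring
  have l1 := two_pow_log_div_four_le hT
  have l2 := le_two_mul_two_pow_log_div_four (T := T)
  have l3 := log_div_four_le hT
  rw [← hJ, ← hq] at l1 l2
  rw [← hJ] at l3
  set l := Real.log T with hl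
  have hl0 : 0 ≤ l := Real.log_nonneg hT1
  have hJ0 : (0 : ℝ) ≤ J := Nat.cast_nonneg J
  have hJx : (J : ℝ) + 1 ≤ 1 + l := by linarith
  have hn1 : n ≤ 4 * (q * (1 + l)) := by
    rw [hn]
    have := mul_le_mul (show (2 : ℝ) ^ J + 1 ≤ 2 * q by linarith) hJx (by positivity) (by positivity)
    linarith
  have hn0 : 0 < n := by rw [hn]; positivity
  have hlogn : Real.log n ≤ 2 * (1 + l) := by
    have h1 := Real.log_le_log hn0 hn1
    rw [Real.log_mul (by norm_num) (by positivity), Real.log_mul (by positivity) (by positivity)]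
      at h1
    have h2 : Real.log q = 1 / 4 * l := by rw [hq, Real.log_rpow (by linarith)]
    have h3 := Real.log_le_sub_one_of_pos (show (0 : ℝ) < 1 + l by linarith)
    have h4 : Real.log 4 ≤ 2 := by
      rw [show (4 : ℝ) = 2 ^ 2 by norm_num, Real.log_pow]
      have := Real.log_two_lt_d9
      push_cast
      linarith
    linarith
  have hlognT : Real.log (n * T) ≤ 3 * (1 + l) := by
    rw [Real.log_mul hn0.ne' (by positivity)]
    linarith
  set x := 1 + l with hx
  have hx1 : 1 ≤ x := by linarith
  have hM : dualBound T = 16 * (x - 1) := by rw [dualBound, ← hl, hx]; ring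
  have hx3 : x ≤ x ^ 3 := le_self_pow₀ hx1 (by norm_num)
  have hx23 : x ^ 2 ≤ x ^ 3 := pow_le_pow_right₀ hx1 (by norm_num)
  have hq3 : q ≤ q ^ 3 := le_self_pow₀ hq1 (by norm_num)
  have hq23 : q ^ 2 ≤ q ^ 3 := pow_le_pow_right₀ hq1 (by norm_num)
  have t1 : 2 * dualBound T ≤ 32 * (q ^ 3 * x ^ 3) := by
    have : 1 * x ≤ q ^ 3 * x ^ 3 :=
      mul_le_mul (one_le_pow₀ hq1) hx3 (by positivity) (by positivity)
    rw [hM]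
    linarith
  have t2 : 4 * (J + 1) * (4 * n * (Real.log n + Real.log (n * T))) ≤ 320 * (q ^ 3 * x ^ 3) := by
    calc 4 * (J + 1) * (4 * n * (Real.log n + Real.log (n * T)))
        ≤ 4 * x * (4 * (4 * (q * x)) * (5 * x)) := by
          have h1 : Real.log n + Real.log (n * T) ≤ 5 * x := by linarith
          have h2 : 4 * n * (Real.log n + Real.log (n * T)) ≤ 4 * (4 * (q * x)) * (5 * x) :=
            (mul_le_mul_of_nonneg_left h1 (by positivity)).trans
              (mul_le_mul_of_nonneg_right (by linarith) (by positivity))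
          exact (mul_le_mul_of_nonneg_left h2 (by positivity)).trans
            (mul_le_mul_of_nonneg_right (by linarith) (by positivity))
      _ = 320 * (q * x ^ 3) := by ring
      _ ≤ 320 * (q ^ 3 * x ^ 3) := by gcongr
  have t3 : 8 * T / 2 ^ J ≤ 16 * (q ^ 3 * x ^ 3) := by
    rw [div_le_iff₀ (by positivity), eT]
    calc 8 * q ^ 4 = 8 * q ^ 3 * q := by ring
      _ ≤ 8 * q ^ 3 * (2 * 2 ^ J) := by gcongr
      _ = 16 * (q ^ 3 * 1) * 2 ^ J := by ring
      _ ≤ 16 * (q ^ 3 * x ^ 3) * 2 ^ J := by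
          gcongr
          exact one_le_pow₀ hx1
  have t4 : (1 + dualBound T) * √T * x ≤ 16 * (q ^ 3 * x ^ 3) := by
    rw [e2, hM]
    calc (1 + 16 * (x - 1)) * q ^ 2 * x ≤ 16 * x * q ^ 2 * x := by
          gcongr
          linarith
      _ = 16 * (q ^ 2 * x ^ 2) := by ring
      _ ≤ 16 * (q ^ 3 * x ^ 3) := by gcongr
  rw [e3]
  linarith

end Numerics

/-! ### Benchmarks on the grid -/

/-- The point mass at `(0, 0)` makes the feasible sets of both grid benchmarks nonempty, so their
suprema can be approached. -/
theorem exists_gridPolicy_expRev_eq_zero {K : ℕ} (hK : 2 ≤ K) :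
    ∃ π ∈ gridPolicies K, ∀ L, expRev π L = 0 := by
  refine ⟨⟨Measure.dirac (0, 0), inferInstance⟩, ?_, fun L => ?_⟩
  · have h0 : ((0, 0) : Pair) ∈ grid K := ⟨⟨0, by omega⟩, ⟨0, by omega⟩, by simp⟩
    change Measure.dirac ((0, 0) : Pair) (grid K)ᶜ = 0
    rw [Measure.dirac_apply]
    simp [h0]
  · have h : ∀ x, polRev ⟨Measure.dirac (0, 0), inferInstance⟩ x = 0 := fun x => by
      simp [polRev, rev]
    simp [expRev, h]

theorem exists_gridPolicy_optDGrid_le (T : ℕ) {K : ℕ} (hK : 2 ≤ K)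
    (L : ℕ → ProbabilityMeasure Pair) :
    ∃ π ∈ gridPolicies K, 0 ≤ ∑ t ∈ Finset.range T, expRev π (L t) ∧
      optDGrid T K L ≤ ∑ t ∈ Finset.range T, expGft π (L t) + 1 := by
  obtain ⟨π₀, h₀, hz⟩ := exists_gridPolicy_expRev_eq_zero hK
  obtain ⟨r, ⟨π, hπ, hrev, rfl⟩, hr⟩ := exists_lt_of_lt_csSup
    (s := {r | ∃ π ∈ gridPolicies K, 0 ≤ ∑ t ∈ Finset.range T, expRev π (L t) ∧
      r = ∑ t ∈ Finset.range T, expGft π (L t)})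
    ⟨_, π₀, h₀, by simp [hz], rfl⟩ (sub_one_lt (optDGrid T K L))
  exact ⟨π, hπ, hrev, by linarith⟩

theorem exists_gridPolicy_optFGrid_le (T : ℕ) {K : ℕ} (hK : 2 ≤ K)
    (L : ℕ → ProbabilityMeasure Pair) :
    ∃ π ∈ gridPolicies K, (∀ t ∈ Finset.range T, -(1 / (K : ℝ)) ≤ expRev π (L t)) ∧
      optFGrid T K L ≤ ∑ t ∈ Finset.range T, expGft π (L t) + 1 := by
  obtain ⟨π₀, h₀, hz⟩ := exists_gridPolicy_expRev_eq_zero hK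
  obtain ⟨r, ⟨π, hπ, hrev, rfl⟩, hr⟩ := exists_lt_of_lt_csSup
    (s := {r | ∃ π ∈ gridPolicies K, (∀ t ∈ Finset.range T, -(1 / (K : ℝ)) ≤ expRev π (L t)) ∧
      r = ∑ t ∈ Finset.range T, expGft π (L t)})
    ⟨_, π₀, h₀, fun t _ => by rw [hz]; simp, rfl⟩ (sub_one_lt (optFGrid T K L))
  exact ⟨π, hπ, hrev, by linarith⟩

/-! ### The regret of the algorithm -/

/-- On the events where Rev-Max has small regret and the reward of a grid policy concentrates, the
policy does not outperform the algorithm by more than the regrets and the error terms. -/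
theorem sum_expGft_add_le_totalGft {T : ℕ} (hT : 2 ^ 15 ≤ T) (Q : Procedure (Bool × ℝ))
    (L : ℕ → ProbabilityMeasure Pair) {K : ℕ} {π : ProbabilityMeasure Pair}
    (hπ : π ∈ gridPolicies K) (ωR : (revMax T).Seed) (ωQ : Q.Seed) (v : ℕ → Pair)
    (hgap : ∑ t ∈ Finset.range T, rewardGap (revMax T) Q T π L ωR ωQ v t
      ≤ (1 + dualBound T) * √T * (1 + Real.log T))
    (hbandit : ∀ k, (∑ s ∈ Finset.range T, if (run (revMax T) Q T ωR ωQ v s).budget < 1 then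
        rev (armPrice (Nat.log 2 T / 4) k) (v s) else 0)
      ≤ 8 * (∑ s ∈ Finset.range T, if (run (revMax T) Q T ωR ωQ v s).budget < 1 then
          rev (posted (revMax T) Q T ωR ωQ v s) (v s) else 0)
        + 4 * Fintype.card (PriceArm (Nat.log 2 T / 4)) *
          (Real.log (Fintype.card (PriceArm (Nat.log 2 T / 4)))
            + Real.log (Fintype.card (PriceArm (Nat.log 2 T / 4)) * T))) :
    ∑ t ∈ Finset.range T, expGft π (L t)
      + ∑ t ∈ Finset.range T, revWeight (revMax T) Q T ωR ωQ v t * expRev π (L t)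
    ≤ totalGft (revMax T) Q T ωR ωQ v + primalRegret (revMax T) Q T ωR ωQ K v
      + 2 * dualRegret (revMax T) Q T ωR ωQ v
      + 384 * (T : ℝ) ^ (3 / 4 : ℝ) * (1 + Real.log T) ^ 3 := by
  have hT1 : 1 ≤ T := le_trans (by norm_num) hT
  set J := Nat.log 2 T / 4 with hJ
  set n : ℝ := (Fintype.card (PriceArm J) : ℝ) with hn
  have hn' : n = (2 ^ J + 1) * ((J + 1) * 2) := by
    rw [hn]; simp [Fintype.card_prod]
  set S := ∑ s ∈ Finset.range T, if (run (revMax T) Q T ωR ωQ v s).budget < 1 then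
    rev (posted (revMax T) Q T ωR ωQ v s) (v s) else 0 with hS
  have hS0 : 0 ≤ S := Finset.sum_nonneg fun t _ => by
    split_ifs with h
    · exact rev_nonneg_of_le (posted_le_of_budget_lt Q T ωR ωQ v (revMax_noSubsidy T) h) _
    · exact le_rfl
  set Z := 4 * n * (Real.log n + Real.log (n * T)) with hZ
  have hD : ∀ p, (∑ t ∈ Finset.range T, if (run (revMax T) Q T ωR ωQ v t).budget < 1 then
      gft (p, p) (v t) else 0) ≤ 2 * (J + 1) * (8 * S + Z) + T * (4 / 2 ^ J) := fun p => by
    rw [← Finset.sum_filter]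
    refine (sum_gft_le_of_sum_rev_le J _ v (Y := 8 * S + Z) (fun a => ?_) p).trans ?_
    · rw [Finset.sum_filter]
      exact hbandit a
    · have hc := Finset.card_filter_le (Finset.range T)
        fun t => (run (revMax T) Q T ωR ωQ v t).budget < 1
      rw [Finset.card_range] at hc
      gcongr
  have hmain := sum_expGft_add_le Q T ωR ωQ v (revMax_noSubsidy T) hT1 hπ L hgap hD
  have herr := error_terms_le hT1 hJ hn'
  -- The coefficient of `S` in `2 D` is `2 · 2(J+1) · 8`. Four fifths of `log T` cover `2 J`, and
  -- the remaining fifth covers `2` because `log T ≥ 10`.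
  have hM : 32 * ((J : ℝ) + 1) ≤ dualBound T := by
    have h1 := log_div_four_le hT1
    have h2 := ten_le_log hT
    rw [← hJ] at h1
    rw [dualBound]
    linarith
  have hMS := mul_le_mul_of_nonneg_right hM hS0
  have e : (8 : ℝ) * T / 2 ^ J = 2 * (T * (4 / 2 ^ J)) := by ring
  rw [← hZ, e] at herr
  linarith

theorem jointLaw_le_one (R : Procedure Bool) (Q : Procedure (Bool × ℝ))
    (L : ℕ → ProbabilityMeasure Pair) (s : Set (R.Seed × Q.Seed × (ℕ → Pair))) :
    jointLaw R Q L s ≤ 1 := by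
  unfold jointLaw
  exact prob_le_one

end BilateralTrade

/-! ### Union bound and choice of constants -/

theorem mainTheorem7 :
    ∃ R : ℕ → BilateralTrade.Procedure Bool,
      (∀ T : ℕ, BilateralTrade.NoSubsidy (R T)) ∧
      ∀ κ : ℝ, 0 < κ → ∃ (A c : ℝ) (d : ℕ),
        ∀ (T K : ℕ) (Q : BilateralTrade.Procedure (Bool × ℝ))
          (L : ℕ → MeasureTheory.ProbabilityMeasure BilateralTrade.Pair)
          (P : MeasureTheory.ProbabilityMeasure BilateralTrade.Pair),
          1 ≤ T → 2 ≤ K →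
          BilateralTrade.jointLaw (R T) Q L
            {ω | ¬ (BilateralTrade.optD T L
                      - BilateralTrade.totalGft (R T) Q T ω.1 ω.2.1 ω.2.2
                    ≤ BilateralTrade.primalRegret (R T) Q T ω.1 ω.2.1 K ω.2.2
                      + 2 * BilateralTrade.dualRegret (R T) Q T ω.1 ω.2.1 ω.2.2
                      + 2 * BilateralTrade.dualBound T * BilateralTrade.corruption T L P
                      + A * (T : ℝ) ^ (3 / 4 : ℝ) * (1 + Real.log T) ^ d
                      + BilateralTrade.gridRegretD T K L ∧
                  ((T : ℝ) ^ (1 / 4 : ℝ) ≤ κ * K →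
                    BilateralTrade.optF T ω.2.2
                      - BilateralTrade.totalGft (R T) Q T ω.1 ω.2.1 ω.2.2
                    ≤ BilateralTrade.primalRegret (R T) Q T ω.1 ω.2.1 K ω.2.2
                      + 2 * BilateralTrade.dualRegret (R T) Q T ω.1 ω.2.1 ω.2.2
                      + A * (T : ℝ) ^ (3 / 4 : ℝ) * (1 + Real.log T) ^ d
                      + BilateralTrade.gridRegretF T K L ω.2.2))}
            ≤ ENNReal.ofReal (c / T) := by
  open BilateralTrade in
  -- In `A`, `384` comes from `error_terms_le`, `1` from using a policy within `1` of the supremum,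
  -- and `16 κ` from the revenue slack `M T / K`. The value `c = 2^15` makes the claim trivial for
  -- `T < 2^15`.
  refine ⟨revMax, revMax_noSubsidy, fun κ hκ => ⟨385 + 16 * κ, 2 ^ 15, 3, ?_⟩⟩
  intro T K Q L P hT hK
  have hT0 : (0 : ℝ) < T := by exact_mod_cast hT
  rcases lt_or_ge T (2 ^ 15) with hsmall | hlarge
  · refine (jointLaw_le_one _ _ _ _).trans ?_
    rw [← ENNReal.ofReal_one]
    refine ENNReal.ofReal_le_ofReal ((one_le_div hT0).2 ?_)
    exact_mod_cast hsmall.le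
  have hlog := ten_le_log hlarge
  have hM : 1 ≤ dualBound T := by rw [dualBound]; linarith
  -- Both policies depend only on the laws `L`, not on the realized valuations, so concentration is
  -- needed for just two fixed policies.
  obtain ⟨π, hπ, hπrev, hπopt⟩ := exists_gridPolicy_optDGrid_le T hK L
  obtain ⟨π', hπ', hπrev', hπopt'⟩ := exists_gridPolicy_optFGrid_le T hK L
  have hb := jointLaw_bandit_regret (pr := armPrice (Nat.log 2 T / 4)) Q T (armPrice_le _) L hT
  have hg := jointLaw_rewardGap (revMax T) Q π L hM hT
  have hg' := jointLaw_rewardGap (revMax T) Q π' L hM hT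
  have hX1 : 1 ≤ (T : ℝ) ^ (3 / 4 : ℝ) * (1 + Real.log T) ^ 3 :=
    one_le_mul_of_one_le_of_one_le
      (Real.one_le_rpow (by exact_mod_cast hT) (by norm_num)) (one_le_pow₀ (by linarith))
  have hκX : 0 ≤ κ * ((T : ℝ) ^ (3 / 4 : ℝ) * (1 + Real.log T) ^ 3) := by positivity
  refine (measure_mono ?_).trans ((measure_union_le _ _).trans
    ((add_le_add ((measure_union_le _ _).trans (add_le_add hg hg')) hb).trans ?_))
  · intro ω hω
    by_contra hgood
    simp only [Set.mem_union, Set.mem_ofPred_eq, not_or, not_not] at hgood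
    obtain ⟨⟨h1, h2⟩, h3⟩ := hgood
    refine hω ⟨?_, fun hTK => ?_⟩
    · have hmain := sum_expGft_add_le_totalGft hlarge Q L hπ ω.1 ω.2.1 ω.2.2 h1 h3
      have hC := neg_corruption_le_sum_mul_expRev P π hπrev
        (revWeight_mem (revMax T) Q hM ω.1 ω.2.1 ω.2.2)
      rw [gridRegretD]
      linarith
    · have hmain := sum_expGft_add_le_totalGft hlarge Q L hπ' ω.1 ω.2.1 ω.2.2 h2 h3
      have hK0 : (0 : ℝ) < K := by exact_mod_cast (by omega : 0 < K)
      have hC : -(dualBound T * (T / K)) ≤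
          ∑ t ∈ Finset.range T, revWeight (revMax T) Q T ω.1 ω.2.1 ω.2.2 t * expRev π' (L t) := by
        have : ∑ _t ∈ Finset.range T, -(dualBound T * (1 / K)) ≤
            ∑ t ∈ Finset.range T, revWeight (revMax T) Q T ω.1 ω.2.1 ω.2.2 t * expRev π' (L t) := by
          refine Finset.sum_le_sum fun t ht => ?_
          obtain ⟨w0, w1⟩ := revWeight_mem (revMax T) Q hM ω.1 ω.2.1 ω.2.2 t
          have i1 := mul_le_mul_of_nonneg_left (hπrev' t ht) w0
          have i2 := mul_le_mul_of_nonneg_right w1 (by positivity : (0 : ℝ) ≤ 1 / K)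
          linarith
        rw [Finset.sum_const, Finset.card_range, nsmul_eq_mul] at this
        refine le_of_eq_of_le ?_ this
        ring
      -- The only use of `T^{1/4} ≤ κ K`: the slack `1/K` per round adds up to order `T^{3/4}`.
      have hTdiv : (T : ℝ) / K ≤ κ * (T : ℝ) ^ (3 / 4 : ℝ) := by
        rw [div_le_iff₀ hK0]
        calc (T : ℝ) = (T : ℝ) ^ (3 / 4 : ℝ) * (T : ℝ) ^ (1 / 4 : ℝ) := by
              rw [← Real.rpow_add hT0]; norm_num
          _ ≤ (T : ℝ) ^ (3 / 4 : ℝ) * (κ * K) := by gcongr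
          _ = κ * (T : ℝ) ^ (3 / 4 : ℝ) * K := by ring
      have hMT : dualBound T * (T / K)
          ≤ 16 * (κ * ((T : ℝ) ^ (3 / 4 : ℝ) * (1 + Real.log T) ^ 3)) := by
        have i1 : dualBound T ≤ 16 * (1 + Real.log T) ^ 3 := by
          have := le_self_pow₀ (show 1 ≤ 1 + Real.log T by linarith) (show 3 ≠ 0 by norm_num)
          rw [dualBound]
          linarith
        calc _ ≤ 16 * (1 + Real.log T) ^ 3 * (κ * (T : ℝ) ^ (3 / 4 : ℝ)) :=
              mul_le_mul i1 hTdiv (by positivity) (by positivity)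
          _ = _ := by ring
      rw [gridRegretF]
      linarith
  · rw [← ENNReal.ofReal_add (by positivity) (by positivity),
      ← ENNReal.ofReal_add (by positivity) (by positivity)]
    refine ENNReal.ofReal_le_ofReal ?_
    rw [← add_div, ← add_div]
    gcongr
    -- Three bad events of probability at most `1 / T` each, and `3 ≤ 2^15`.
    norm_num
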